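/- Let $d\ge 1$ be an integer and let $\ell>d$ and $c,C,\lambda,\kappa,c_1,C_1,c_2,C_2>0$ be real constants. Then there is a constant $M>0$, depending only on these quantities, such that for every $C''$ there is a $K_0$ such that the following holds for all integers $K\ge K_0$ and all $\epsilon,q$ with $q\le 1$, $$c_1\le \epsilon K^{\frac{1}{3-d/\ell}}\le C_1,\qquad c_2\le q\,K^{\frac{1-d/\ell}{6-2d/\ell}}\le C_2 .$$ Setting. Let $L>0$, $\mathbb T^d=[-L,L]^d$, $\omega_n=\frac{\pi}{L}n$ for $n\in\mathbb Z^d$, and let $f:\mathbb R^d\to\mathbb C$ be $2L$-periodic in each component and equal to the sum of its Fourier series, $f(x)=\sum_{n\in\mathbb Z^d}\hat f(\omega_n)e^{\mathrm i\omega_n\cdot x}$, with $$\Big(\frac{c}{|n|}\Big)^{\ell}\le|\hat f(\omega_n)|\le\Big(\frac{C}{|n|}\Big)^{\ell},\qquad n\in\mathbb Z^d\setminus\{0\},$$ where $|n|$ is the Euclidean norm. Let $\rho$ be a probability density on $\mathbb T^d$ with $\rho\ge\kappa(2L)^{-d}$ almost everywhere (for the uniform density one can take $\kappa=1$), and write $\mathbb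 E_x[g(x)]=\int_{\mathbb T^d}g(x)\rho(x)\,dx$. Let $p$ be a probability distribution on $\{\omega_n:n\in\mathbb Z^d\}$ with $\sup_n|\hat f(\omega_n)|/p(\omega_n)\le C''$. Method (infinite amount of data). For a finite list of frequencies $w=(w_k)$ consider the problem $$\min_{v}\Big(\mathbb E_x\Big[\Big|\sum_k v_ke^{\mathrm i w_k\cdot x}-f(x)\Big|^2\Big]+\lambda\sum_k|v_k|^2\Big)\qquad(\ast)$$ over complex amplitudes $v$. Draw independent $\nu_1,\dots,\nu_K$ from $p$, let $\hat\beta$ solve $(\ast)$ with $w=\nu$, and let $\bar\beta_n=\sum_{k:\nu_k=\omega_n}\hat\beta_k$. Given $\nu$, draw independently $\lfloor K(1-q)\rfloor$ frequencies $\bar\nu$ from the distribution that gives $\omega_n$ the probability $|\bar\beta_n|/\sum_{m:|\bar\beta_m|\ge\epsilon}|\bar\beta_m|$ if $|\bar\beta_n|\ge\epsilon$ and $0$ otherwise, and $\lceil Kq\rceil$ frequencies $\tilde\nu$ from $p$ (if no $n$ satisfies $|\bar\beta_n|\ge\epsilon$, the frequencies $\bar\nu$ are drawn from an arbitrary fixed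 distribution instead). Let $\bar\omega=(\bar\nu,\tilde\nu)$, let $\check p$ be the joint law of $(\nu,\bar\omega)$, and let $\alpha(x;\bar\omega)=\sum_{k=1}^K\hat\alpha_ke^{\mathrm i\bar\omega_k\cdot x}$, where $\hat\alpha$ solves $(\ast)$ with $w=\bar\omega$. Conclusion. $$\mathbb E_{\check p}\big[\mathbb E_x[|\alpha(x;\bar\omega)-f(x)|^2]\big]\le\mathbb E_{\check p}\Big[\min_{v\in\mathbb C^K}\Big(\mathbb E_x\Big[\Big|\sum_{k=1}^Kv_ke^{\mathrm i\bar\omega_k\cdot x}-f(x)\Big|^2\Big]+\lambda\sum_{k=1}^K|v_k|^2\Big)\Big]\le\frac{1+\lambda}{K}\Big(\sum_{n\in\mathbb Z^d}|\hat f(\omega_n)|\Big)^2\big(1+C''M q^{1/2}\big).$$ Moreover $\big(\sum_n|\hat f(\omega_n)|\big)^2$ is the optimal rate constant: it is the minimum of $C_{p'}(f)=\sum_n|\hat f(\omega_n)|^2/p'(\omega_n)$ over all probability distributions $p'$ on $\{\omega_n : n\in\mathbb Z^d\}$ (with $0/0=0$, and $C_{p'}(f)=\infty$ if $p'(\omega_n)=0\ne\hat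 f(\omega_n)$ for some $n$). -/

import Mathlib

open MeasureTheory ProbabilityTheory
open scoped ENNReal

noncomputable section

namespace RandomFeatures

variable {d : ℕ}

/-- The period cell `𝕋^d = [-L, L]^d`. -/
def cell (d : ℕ) (L : ℝ) : Set (Fin d → ℝ) :=
  Set.Icc (fun _ => -L) (fun _ => L)

/-- The Fourier mode `x ↦ exp(i ω_n · x)` with frequency `ω_n = (π / L) n`, `n ∈ ℤ^d`.
Lattice frequencies are represented throughout by their index `n`. -/
def mode (L : ℝ) (n : Fin d → ℤ) (x : Fin d → ℝ) : ℂ :=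
  Complex.exp (Complex.I * ((∑ i, (Real.pi / L * (n i : ℝ)) * x i : ℝ) : ℂ))

/-- The Fourier coefficient `f̂(ω_n) = (2L)^{-d} ∫_{𝕋^d} f(x) exp(-i ω_n · x) dx`. -/
def fourierCoefficient (L : ℝ) (f : (Fin d → ℝ) → ℂ) (n : Fin d → ℤ) : ℂ :=
  (((2 * L) ^ d)⁻¹ : ℝ) * ∫ x in cell d L, f x * (starRingEnd ℂ) (mode L n x)

/-- The Euclidean length `|n|` of a lattice point. -/
def latticeNorm (n : Fin d → ℤ) : ℝ :=
  √(∑ i, (n i : ℝ) ^ 2)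

/-- `f` is the (pointwise) sum of its Fourier series; in particular it is `2L`-periodic in each
component. -/
def HasFourierSeries (L : ℝ) (f : (Fin d → ℝ) → ℂ) : Prop :=
  ∀ x, HasSum (fun n : Fin d → ℤ => fourierCoefficient L f n * mode L n x) (f x)

/-- Two-sided power decay `(c/|n|)^ℓ ≤ |f̂(ω_n)| ≤ (C/|n|)^ℓ` for `n ≠ 0`. -/
def HasDecay (L c C ℓ : ℝ) (f : (Fin d → ℝ) → ℂ) : Prop :=
  ∀ n : Fin d → ℤ, n ≠ 0 →
    (c / latticeNorm n) ^ ℓ ≤ ‖fourierCoefficient L f n‖ ∧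
      ‖fourierCoefficient L f n‖ ≤ (C / latticeNorm n) ^ ℓ

/-- `ρ` is a probability density on the period cell that is at least `κ` times the density
`(2L)^{-d}` of the uniform distribution. -/
structure IsDataDensity (L κ : ℝ) (ρ : (Fin d → ℝ) → ℝ) : Prop where
  integrable : IntegrableOn ρ (cell d L)
  integral_eq_one : ∫ x in cell d L, ρ x = 1
  lower_bound : ∀ᵐ x ∂(volume.restrict (cell d L)), κ * ((2 * L) ^ d)⁻¹ ≤ ρ x

/-- The network `x ↦ ∑ₖ vₖ exp(i ωₖ · x)` with frequencies `ω` and amplitudes `v`. -/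
def network {ι : Type} [Fintype ι] (L : ℝ) (ω : ι → Fin d → ℤ) (v : ι → ℂ)
    (x : Fin d → ℝ) : ℂ :=
  ∑ k, v k * mode L (ω k) x

/-- `𝔼ₓ[|g(x) - f(x)|²]`, for `x` with density `ρ` on the period cell. -/
def genError (L : ℝ) (ρ : (Fin d → ℝ) → ℝ) (f g : (Fin d → ℝ) → ℂ) : ℝ :=
  ∫ x in cell d L, ‖g x - f x‖ ^ 2 * ρ x

/-- The regularized least squares functional for an infinite amount of data:
`𝔼ₓ[|∑ₖ vₖ exp(i ωₖ · x) - f(x)|²] + λ ∑ₖ |vₖ|²`. -/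
def loss {ι : Type} [Fintype ι] (L : ℝ) (ρ : (Fin d → ℝ) → ℝ) (lam : ℝ)
    (f : (Fin d → ℝ) → ℂ) (ω : ι → Fin d → ℤ) (v : ι → ℂ) : ℝ :=
  genError L ρ f (network L ω v) + lam * ∑ k, ‖v k‖ ^ 2

/-- `v` solves the random Fourier feature problem with frequencies `ω`. -/
def IsSolution {ι : Type} [Fintype ι] (L : ℝ) (ρ : (Fin d → ℝ) → ℝ) (lam : ℝ)
    (f : (Fin d → ℝ) → ℂ) (ω : ι → Fin d → ℤ) (v : ι → ℂ) : Prop :=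
  ∀ w : ι → ℂ, loss L ρ lam f ω v ≤ loss L ρ lam f ω w

/-- `β̄_n = ∑_{k : ν_k = ω_n} β̂_k`. -/
def combinedAmplitude {ι : Type} [Fintype ι] (ν : ι → Fin d → ℤ) (b : ι → ℂ)
    (n : Fin d → ℤ) : ℂ :=
  ∑ k with ν k = n, b k

/-- The weights `|β̄_n|` with the amplitudes smaller than `ε` cut off (replaced by `0`). -/
def cutoffWeight {ι : Type} [Fintype ι] (ε : ℝ) (ν : ι → Fin d → ℤ) (b : ι → ℂ) :
    (Fin d → ℤ) → ℝ≥0∞ :=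
  Set.indicator {n | ε ≤ ‖combinedAmplitude ν b n‖} (fun n => ‖combinedAmplitude ν b n‖ₑ)

theorem tsum_cutoffWeight_ne_top {ι : Type} [Fintype ι] (ε : ℝ) (ν : ι → Fin d → ℤ)
    (b : ι → ℂ) : ∑' n, cutoffWeight ε ν b n ≠ ∞ := by
  have h : ∀ n ∉ Finset.univ.image ν, cutoffWeight ε ν b n = 0 := by
    intro n hn
    have h0 : combinedAmplitude ν b n = 0 := by
      unfold combinedAmplitude
      rw [Finset.filter_false_of_mem, Finset.sum_empty]
      intro k _ hk
      exact hn (Finset.mem_image.2 ⟨k, Finset.mem_univ k, hk⟩)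
    simp [cutoffWeight, Set.indicator, h0]
  rw [tsum_eq_sum h]
  refine ENNReal.sum_ne_top.2 fun n _ => ?_
  unfold cutoffWeight Set.indicator
  split_ifs <;> simp

open Classical in
/-- The resampling distribution `p̄(n | ν, ε) = |β̄_n| / ∑_{|β̄_m| ≥ ε} |β̄_m|` on the set
`|β̄_n| ≥ ε`. On the event that no amplitude survives the cutoff, where this quotient is not
defined, it is the distribution `r`. -/
def resampleDist {ι : Type} [Fintype ι] (r : PMF (Fin d → ℤ)) (ε : ℝ)
    (ν : ι → Fin d → ℤ) (b : ι → ℂ) : PMF (Fin d → ℤ) :=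
  if h : ∑' n, cutoffWeight ε ν b n ≠ 0 then
    PMF.normalize (cutoffWeight ε ν b) h (tsum_cutoffWeight_ne_top ε ν b)
  else r

/-- Given the seed sample `ν` and its amplitudes `β ν`: the law of `ω̄ = (ν̄, ν̃)`, made of `K₁`
independent frequencies from the resampling distribution and, independently, `K₂` independent
frequencies from `p`. -/
def resampleKernel {K : ℕ} (p r : PMF (Fin d → ℤ)) (ε : ℝ)
    (β : (Fin K → Fin d → ℤ) → Fin K → ℂ) (K₁ K₂ : ℕ) :
    Kernel (Fin K → Fin d → ℤ) (Fin K₁ ⊕ Fin K₂ → Fin d → ℤ) where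
  toFun ν := Measure.pi fun k =>
    (Sum.elim (fun _ : Fin K₁ => resampleDist r ε ν (β ν)) (fun _ : Fin K₂ => p) k).toMeasure
  measurable' := measurable_of_countable _

instance {K : ℕ} (p r : PMF (Fin d → ℤ)) (ε : ℝ)
    (β : (Fin K → Fin d → ℤ) → Fin K → ℂ) (K₁ K₂ : ℕ) :
    IsMarkovKernel (resampleKernel p r ε β K₁ K₂) where
  isProbabilityMeasure ν := by
    change IsProbabilityMeasure (Measure.pi fun k =>
      (Sum.elim (fun _ : Fin K₁ => resampleDist r ε ν (β ν)) (fun _ : Fin K₂ => p) k).toMeasure)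
    infer_instance

/-- The joint law `p̌` of `(ν, ω̄)`: the seed sample `ν` consists of `K` independent frequencies
from `p`, and `ω̄` is drawn given `ν`, with `⌊K(1-q)⌋` resampled frequencies and `⌈Kq⌉`
frequencies from `p`. -/
def resampleLaw {K : ℕ} (p r : PMF (Fin d → ℤ)) (ε q : ℝ)
    (β : (Fin K → Fin d → ℤ) → Fin K → ℂ) :
    Measure ((Fin K → Fin d → ℤ) × (Fin ⌊(K : ℝ) * (1 - q)⌋₊ ⊕ Fin ⌈(K : ℝ) * q⌉₊ → Fin d → ℤ)) :=
  (Measure.pi fun _ : Fin K => p.toMeasure) ⊗ₘ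
    resampleKernel p r ε β ⌊(K : ℝ) * (1 - q)⌋₊ ⌈(K : ℝ) * q⌉₊

/-- The rate constant `C_p(f) = ∑_n |f̂(ω_n)|² / p(ω_n)` (infinite if `p(ω_n) = 0 ≠ f̂(ω_n)` for
some `n`). -/
def rateConstant (L : ℝ) (f : (Fin d → ℝ) → ℂ) (p : PMF (Fin d → ℤ)) : ℝ≥0∞ :=
  ∑' n, ‖fourierCoefficient L f n‖ₑ ^ 2 / p n

end RandomFeatures

end

namespace RandomFeatures

variable {d : ℕ}

/-! The minimal loss is at most the loss of any amplitudes chosen as a function of the sampled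
frequencies. With importance weights that make the network an unbiased estimator of `f`, the mean
square error is a variance of independent terms, hence at most the sum of their second moments; the
penalty contributes `lam` times the same sum. This is the factor `1 + lam` in
`lintegral_iInf_loss_le`.

After resampling the estimator is stratified: modes surviving the cutoff are estimated by the
resampled frequencies, all others by the fresh draws from `p` (`lintegral_iInf_loss_resample_le`).
If the weights `|β̄_n|` were proportional to the true moduli, the first stratum would cost at most
`S ^ 2 / K₁`, where `S` is the sum of the moduli. Bessel's inequality and the lower bound on the
density bound the squared deviation of `β̄` from the true coefficients by seed loss over `κ`. So the
excess of the first stratum and the mass of wrongly discarded modes are both linear in the seed loss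
(`sum_survivors_mul_sum_le`, `tsum_not_survivors_le`), whose mean is `O(1/K)`. Genuinely small
coefficients contribute `O(ε ^ (1 - d/ℓ))` by a layer-cake count (`HasDecay.tsum_small_le`).

Under the prescribed scaling every relative error is `O(q)`, and `q ≤ √q`. Optimality of `S ^ 2` is
Cauchy–Schwarz in the form of a termwise arithmetic-geometric inequality. -/

/-! ### Fourier modes on the period cell and Bessel's inequality. -/

theorem continuous_mode (L : ℝ) (n : Fin d → ℤ) : Continuous (mode L n) := by
  unfold mode; fun_prop

theorem norm_mode (L : ℝ) (n : Fin d → ℤ) (x : Fin d → ℝ) : ‖mode L n x‖ = 1 := by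
  unfold mode; rw [mul_comm]; exact Complex.norm_exp_ofReal_mul_I _

theorem mode_eq_prod (L : ℝ) (n : Fin d → ℤ) (x : Fin d → ℝ) :
    mode L n x = ∏ i, Complex.exp (Complex.I * (Real.pi / L * n i : ℝ) * (x i : ℝ)) := by
  unfold mode
  rw [← Complex.exp_sum]
  congr 1
  push_cast
  rw [Finset.mul_sum]
  exact Finset.sum_congr rfl fun i _ => by ring

theorem mode_mul_conj_mode (L : ℝ) (m n : Fin d → ℤ) (x : Fin d → ℝ) :
    mode L m x * (starRingEnd ℂ) (mode L n x) = mode L (m - n) x := by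
  unfold mode
  rw [← Complex.exp_conj, ← Complex.exp_add]
  congr 1
  simp only [map_mul, Complex.conj_I, Complex.conj_ofReal, Pi.sub_apply]
  rw [neg_mul, ← sub_eq_add_neg, ← mul_sub, ← Complex.ofReal_sub, ← Finset.sum_sub_distrib]
  congr 3
  funext i
  push_cast
  ring

theorem integral_exp_period {L : ℝ} (hL : 0 < L) (j : ℤ) :
    ∫ t in Set.Icc (-L) L, Complex.exp (Complex.I * (Real.pi / L * j : ℝ) * (t : ℝ)) =
      if j = 0 then ((2 * L : ℝ) : ℂ) else 0 := by
  rw [integral_Icc_eq_integral_Ioc, ← intervalIntegral.integral_of_le (by linarith)]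
  split_ifs with h
  · simp [h]; ring
  · have hc : Complex.I * ((Real.pi / L * j : ℝ) : ℂ) ≠ 0 := by
      refine mul_ne_zero Complex.I_ne_zero ?_
      norm_cast
      have : (j : ℝ) ≠ 0 := by exact_mod_cast h
      have := Real.pi_ne_zero
      positivity
    rw [integral_exp_mul_complex hc, div_eq_zero_iff]
    left
    rw [sub_eq_zero, Complex.exp_eq_exp_iff_exists_int]
    -- The exponents at the endpoints are `iπj` and `-iπj`, which differ by `j` periods `2πi`.
    refine ⟨j, ?_⟩
    have : (L : ℂ) ≠ 0 := by exact_mod_cast hL.ne'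
    push_cast
    field_simp
    ring

theorem cell_eq_pi (L : ℝ) : cell d L = Set.univ.pi fun _ => Set.Icc (-L) L :=
  (Set.pi_univ_Icc _ _).symm

theorem integral_mode {L : ℝ} (hL : 0 < L) (n : Fin d → ℤ) :
    ∫ x in cell d L, mode L n x = if n = 0 then (((2 * L) ^ d : ℝ) : ℂ) else 0 := by
  simp_rw [mode_eq_prod]
  rw [cell_eq_pi, volume_pi, Measure.restrict_pi_pi, integral_fintype_prod_eq_prod
    (fun i (t : ℝ) => Complex.exp (Complex.I * (Real.pi / L * n i : ℝ) * (t : ℝ)))]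
  simp_rw [integral_exp_period hL]
  split_ifs with h
  · simp [h]
  · obtain ⟨i, hi⟩ := Function.ne_iff.1 h
    exact Finset.prod_eq_zero (Finset.mem_univ i) (if_neg (by simpa using hi))

theorem fourierCoefficient_mode {L : ℝ} (hL : 0 < L) (m n : Fin d → ℤ) :
    fourierCoefficient L (mode L m) n = if m = n then 1 else 0 := by
  unfold fourierCoefficient
  simp_rw [mode_mul_conj_mode, integral_mode hL, sub_eq_zero]
  split_ifs
  · rw [← Complex.ofReal_mul, inv_mul_cancel₀ (by positivity), Complex.ofReal_one]
  · simp

theorem _root_.Continuous.integrableOn_cell {E : Type*} [NormedAddCommGroup E] {L : ℝ}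
    {g : (Fin d → ℝ) → E} (hg : Continuous g) : IntegrableOn g (cell d L) :=
  hg.continuousOn.integrableOn_compact isCompact_Icc

theorem integrableOn_mul_conj_mode {L : ℝ} {g : (Fin d → ℝ) → ℂ} (hg : Continuous g)
    (n : Fin d → ℤ) : IntegrableOn (fun x => g x * (starRingEnd ℂ) (mode L n x)) (cell d L) :=
  (hg.mul (Complex.continuous_conj.comp (continuous_mode L n))).integrableOn_cell

theorem fourierCoefficient_sub {L : ℝ} {g h : (Fin d → ℝ) → ℂ} (hg : Continuous g)
    (hh : Continuous h) (n : Fin d → ℤ) :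
    fourierCoefficient L (fun x => g x - h x) n =
      fourierCoefficient L g n - fourierCoefficient L h n := by
  unfold fourierCoefficient
  simp_rw [sub_mul]
  rw [integral_sub (integrableOn_mul_conj_mode hg n) (integrableOn_mul_conj_mode hh n), mul_sub]

theorem fourierCoefficient_sum_mode {ι : Type*} {L : ℝ} (hL : 0 < L) (s : Finset ι)
    (ω : ι → Fin d → ℤ) (v : ι → ℂ) (n : Fin d → ℤ) :
    fourierCoefficient L (fun x => ∑ k ∈ s, v k * mode L (ω k) x) n =
      ∑ k ∈ s, if ω k = n then v k else 0 := by
  have h : ∀ k, ((((2 * L) ^ d)⁻¹ : ℝ) : ℂ) *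
      ∫ x in cell d L, v k * mode L (ω k) x * (starRingEnd ℂ) (mode L n x) =
      if ω k = n then v k else 0 := by
    intro k
    have := fourierCoefficient_mode hL (ω k) n
    unfold fourierCoefficient at this
    simp_rw [mul_assoc]
    rw [integral_const_mul, mul_left_comm, this]
    simp
  unfold fourierCoefficient
  simp_rw [Finset.sum_mul]
  rw [integral_finsetSum _ fun k _ =>
    integrableOn_mul_conj_mode ((continuous_mode L (ω k)).const_mul (v k)) n, Finset.mul_sum]
  exact Finset.sum_congr rfl fun k _ => h k

theorem continuous_network {ι : Type} [Fintype ι] (L : ℝ) (ω : ι → Fin d → ℤ) (v : ι → ℂ) :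
    Continuous (network L ω v) := by
  unfold network
  exact continuous_finsetSum _ fun k _ => (continuous_mode L (ω k)).const_mul (v k)

theorem fourierCoefficient_network {ι : Type} [Fintype ι] {L : ℝ} (hL : 0 < L)
    (ω : ι → Fin d → ℤ) (v : ι → ℂ) (n : Fin d → ℤ) :
    fourierCoefficient L (network L ω v) n = combinedAmplitude ω v n := by
  unfold network combinedAmplitude
  rw [fourierCoefficient_sum_mode hL, Finset.sum_filter]

theorem integral_mul_conj_mode {L : ℝ} (hL : 0 < L) (g : (Fin d → ℝ) → ℂ) (n : Fin d → ℤ) :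
    ∫ x in cell d L, g x * (starRingEnd ℂ) (mode L n x) =
      ((2 * L) ^ d : ℝ) * fourierCoefficient L g n := by
  unfold fourierCoefficient
  rw [← mul_assoc, ← Complex.ofReal_mul, mul_inv_cancel₀ (by positivity), Complex.ofReal_one,
    one_mul]

theorem integral_mul_conj_sum_mode {L : ℝ} (hL : 0 < L) {g : (Fin d → ℝ) → ℂ}
    (hg : Continuous g) (F : Finset (Fin d → ℤ)) (a : (Fin d → ℤ) → ℂ) :
    ∫ x in cell d L, g x * (starRingEnd ℂ) (∑ n ∈ F, a n * mode L n x) =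
      ((2 * L) ^ d : ℝ) * ∑ n ∈ F, (starRingEnd ℂ) (a n) * fourierCoefficient L g n := by
  simp_rw [map_sum, Finset.mul_sum, map_mul, mul_left_comm (g _)]
  rw [integral_finsetSum _ fun n _ => (integrableOn_mul_conj_mode hg n).const_mul _]
  refine Finset.sum_congr rfl fun n _ => ?_
  rw [integral_const_mul, integral_mul_conj_mode hL, mul_left_comm]

/-- Bessel's inequality on the period cell. -/
theorem sum_fourierCoefficient_sq_le {L : ℝ} (hL : 0 < L) {g : (Fin d → ℝ) → ℂ}
    (hg : Continuous g) (F : Finset (Fin d → ℤ)) :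
    (2 * L) ^ d * ∑ n ∈ F, ‖fourierCoefficient L g n‖ ^ 2 ≤ ∫ x in cell d L, ‖g x‖ ^ 2 := by
  set a := fourierCoefficient L g
  set h : (Fin d → ℝ) → ℂ := fun x => ∑ n ∈ F, a n * mode L n x with hh
  have hhc : Continuous h :=
    continuous_finsetSum _ fun n _ => (continuous_mode L n).const_mul (a n)
  have hgh : ∫ x in cell d L, g x * (starRingEnd ℂ) (h x) =
      (((2 * L) ^ d * ∑ n ∈ F, ‖a n‖ ^ 2 : ℝ) : ℂ) := by
    rw [integral_mul_conj_sum_mode hL hg]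
    push_cast
    simp_rw [← Complex.conj_mul']
    rfl
  have hhh : ∫ x in cell d L, h x * (starRingEnd ℂ) (h x) =
      (((2 * L) ^ d * ∑ n ∈ F, ‖a n‖ ^ 2 : ℝ) : ℂ) := by
    rw [integral_mul_conj_sum_mode hL hhc]
    push_cast
    simp_rw [← Complex.conj_mul']
    congr 1
    refine Finset.sum_congr rfl fun n hn => ?_
    rw [hh, fourierCoefficient_sum_mode hL, Finset.sum_ite_eq' F n a, if_pos hn]
  have i1 : IntegrableOn (fun x => g x * (starRingEnd ℂ) (h x)) (cell d L) :=
    (hg.mul (Complex.continuous_conj.comp hhc)).integrableOn_cell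
  have i2 : IntegrableOn (fun x => h x * (starRingEnd ℂ) (h x)) (cell d L) :=
    (hhc.mul (Complex.continuous_conj.comp hhc)).integrableOn_cell
  have e1 : ∫ x in cell d L, (g x * (starRingEnd ℂ) (h x)).re =
      (2 * L) ^ d * ∑ n ∈ F, ‖a n‖ ^ 2 := by
    have := integral_re i1
    simp only [RCLike.re_to_complex] at this
    rw [this, hgh, Complex.ofReal_re]
  have e2 : ∫ x in cell d L, (h x * (starRingEnd ℂ) (h x)).re =
      (2 * L) ^ d * ∑ n ∈ F, ‖a n‖ ^ 2 := by
    have := integral_re i2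
    simp only [RCLike.re_to_complex] at this
    rw [this, hhh, Complex.ofReal_re]
  have j1 : IntegrableOn (fun x => (g x * (starRingEnd ℂ) (h x)).re) (cell d L) := i1.re
  have j2 : IntegrableOn (fun x => (h x * (starRingEnd ℂ) (h x)).re) (cell d L) := i2.re
  -- With `h` the partial Fourier sum, this integrates `|g - h|² ≥ 0`; the integrals of `g h̄` and
  -- `|h|²` coincide by orthogonality.
  have key : ∫ x in cell d L, (2 * (g x * (starRingEnd ℂ) (h x)).re -
      (h x * (starRingEnd ℂ) (h x)).re) ≤ ∫ x in cell d L, ‖g x‖ ^ 2 := by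
    refine integral_mono ((j1.const_mul 2).sub j2) (hg.norm.pow 2).integrableOn_cell fun x => ?_
    have := sq_nonneg ‖g x - h x‖
    simp only [← Complex.normSq_eq_norm_sq, Complex.normSq_apply, Complex.mul_re, Complex.conj_re,
      Complex.conj_im, Complex.sub_re, Complex.sub_im] at this ⊢
    nlinarith
  rw [integral_sub (j1.const_mul 2) j2, integral_const_mul, e1, e2] at key
  linarith

/-! ### Absolutely convergent Fourier series and the data density. -/

section Series

variable {L : ℝ} {f : (Fin d → ℝ) → ℂ}

/-- Unconditional summability in `ℂ` is absolute, and modes have modulus one, so convergence at a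
single point suffices. -/
theorem HasFourierSeries.summable_norm (hf : HasFourierSeries L f) :
    Summable fun n => ‖fourierCoefficient L f n‖ := by
  simpa [norm_mode] using (hf 0).summable.norm

theorem HasFourierSeries.continuous (hf : HasFourierSeries L f) : Continuous f := by
  rw [show f = fun x => ∑' n, fourierCoefficient L f n * mode L n x from
    funext fun x => (hf x).tsum_eq.symm]
  exact continuous_tsum (fun n => (continuous_mode L n).const_mul _) hf.summable_norm
    fun n x => by simp [norm_mode]

theorem HasFourierSeries.norm_le (hf : HasFourierSeries L f) (x : Fin d → ℝ) :
    ‖f x‖ ≤ ∑' n, ‖fourierCoefficient L f n‖ := by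
  rw [← (hf x).tsum_eq]
  refine (norm_tsum_le_tsum_norm ?_).trans_eq ?_ <;> simp [norm_mode, hf.summable_norm]

end Series

/-- The probability measure on the period cell with density `ρ`. -/
noncomputable def dataMeasure (L : ℝ) (ρ : (Fin d → ℝ) → ℝ) : Measure (Fin d → ℝ) :=
  (volume.restrict (cell d L)).withDensity fun x => ENNReal.ofReal (ρ x)

section Density

variable {L κ : ℝ} {ρ : (Fin d → ℝ) → ℝ}

theorem IsDataDensity.nonneg (hρ : IsDataDensity L κ ρ) (hL : 0 < L) (hκ : 0 < κ) :
    ∀ᵐ x ∂(volume.restrict (cell d L)), 0 ≤ ρ x :=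
  hρ.lower_bound.mono fun x hx => le_trans (by positivity) hx

theorem IsDataDensity.isProbabilityMeasure (hρ : IsDataDensity L κ ρ) (hL : 0 < L) (hκ : 0 < κ) :
    IsProbabilityMeasure (dataMeasure L ρ) := by
  refine ⟨?_⟩
  rw [dataMeasure, withDensity_apply _ MeasurableSet.univ, Measure.restrict_univ,
    ← ofReal_integral_eq_lintegral_ofReal hρ.integrable (hρ.nonneg hL hκ), hρ.integral_eq_one,
    ENNReal.ofReal_one]

theorem genError_eq_integral (hρ : IsDataDensity L κ ρ) (hL : 0 < L) (hκ : 0 < κ)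
    (f g : (Fin d → ℝ) → ℂ) :
    genError L ρ f g = ∫ x, ‖g x - f x‖ ^ 2 ∂(dataMeasure L ρ) := by
  rw [dataMeasure, integral_withDensity_eq_integral_toReal_smul₀
    hρ.integrable.aestronglyMeasurable.aemeasurable.ennreal_ofReal (by simp)]
  refine integral_congr_ae ?_
  filter_upwards [hρ.nonneg hL hκ] with x hx
  rw [ENNReal.toReal_ofReal hx, smul_eq_mul, mul_comm]

theorem genError_nonneg (hρ : IsDataDensity L κ ρ) (hL : 0 < L) (hκ : 0 < κ)
    (f g : (Fin d → ℝ) → ℂ) : 0 ≤ genError L ρ f g := by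
  rw [genError_eq_integral hρ hL hκ]
  exact integral_nonneg fun x => by positivity

/-- The only place where `ρ` must be bounded below: it lets the error under `ρ` dominate the uniform
error, to which Bessel's inequality applies. -/
theorem sum_fourierCoefficient_sub_sq_le (hρ : IsDataDensity L κ ρ) (hL : 0 < L) (hκ : 0 < κ)
    {f g : (Fin d → ℝ) → ℂ} (hf : Continuous f) (hg : Continuous g) (F : Finset (Fin d → ℤ)) :
    κ * ∑ n ∈ F, ‖fourierCoefficient L g n - fourierCoefficient L f n‖ ^ 2 ≤
      genError L ρ f g := by
  have hB := sum_fourierCoefficient_sq_le hL (hg.sub hf) F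
  have hV : (0 : ℝ) < (2 * L) ^ d := by positivity
  have hc : Continuous fun x => ‖g x - f x‖ ^ 2 := (hg.sub hf).norm.pow 2
  have hint : IntegrableOn (fun x => ‖g x - f x‖ ^ 2 * ρ x) (cell d L) := by
    obtain ⟨B, hBd⟩ := isCompact_Icc.bddAbove_image (K := Set.Icc (fun _ : Fin d => -L) fun _ => L)
      hc.continuousOn
    refine hρ.integrable.bdd_mul (c := B) hc.aestronglyMeasurable ?_
    refine (ae_restrict_iff' (measurableSet_Icc)).2 (Filter.Eventually.of_forall fun x hx => ?_)
    rw [Real.norm_of_nonneg (by positivity)]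
    exact hBd ⟨x, hx, rfl⟩
  have hle : ∫ x in cell d L, (κ * ((2 * L) ^ d)⁻¹) * ‖g x - f x‖ ^ 2 ≤ genError L ρ f g := by
    refine integral_mono_ae (hc.integrableOn_cell.const_mul _) hint ?_
    filter_upwards [hρ.lower_bound] with x hx
    rw [mul_comm]
    exact mul_le_mul_of_nonneg_left hx (by positivity)
  rw [integral_const_mul] at hle
  refine le_trans ?_ hle
  simp_rw [← fourierCoefficient_sub hg hf]
  calc _ = (κ * ((2 * L) ^ d)⁻¹) * ((2 * L) ^ d * ∑ n ∈ F,
        ‖fourierCoefficient L (fun x => g x - f x) n‖ ^ 2) := by field_simp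
    _ ≤ _ := mul_le_mul_of_nonneg_left hB (by positivity)

end Density

/-! ### Variance of independent sums and the unbiased estimator. -/

theorem memLp_of_measurable_of_norm_le {Ω E : Type*} [MeasurableSpace Ω] [NormedAddCommGroup E]
    [MeasurableSpace E] [BorelSpace E] [SecondCountableTopology E] (μ : Measure Ω)
    [IsFiniteMeasure μ] (p : ℝ≥0∞) {h : Ω → E} (hm : Measurable h) {B : ℝ}
    (hb : ∀ x, ‖h x‖ ≤ B) : MemLp h p μ :=
  MemLp.of_bound hm.aestronglyMeasurable B (Filter.Eventually.of_forall hb)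

/-- For independent real random variables, the second moment of the centered sum is at most the sum
of the second moments. -/
theorem integral_pi_sum_sub_sq_le {ι Ω : Type*} [Fintype ι] [MeasurableSpace Ω]
    (μ : ι → Measure Ω) [∀ k, IsProbabilityMeasure (μ k)] {h : ι → Ω → ℝ}
    (hm : ∀ k, Measurable (h k)) {B : ℝ} (hb : ∀ k x, ‖h k x‖ ≤ B) :
    ∫ ω, (∑ k, h k (ω k) - ∑ k, ∫ x, h k x ∂(μ k)) ^ 2 ∂(Measure.pi μ) ≤
      ∑ k, ∫ x, h k x ^ 2 ∂(μ k) := by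
  have hL : ∀ k, MemLp (h k) 2 (μ k) := fun k =>
    memLp_of_measurable_of_norm_le (μ k) 2 (hm k) (hb k)
  have hv := variance_sum_pi hL
  have hmean : ∫ ω, (∑ k, fun ω : ι → Ω => h k (ω k)) ω ∂(Measure.pi μ) =
      ∑ k, ∫ x, h k x ∂(μ k) := by
    simp only [Finset.sum_apply]
    rw [integral_finsetSum]
    · refine Finset.sum_congr rfl fun k _ => ?_
      exact integral_comp_eval (hm k).aestronglyMeasurable
    · intro k _
      exact (memLp_of_measurable_of_norm_le (Measure.pi μ) 1
        ((hm k).comp (measurable_pi_apply k)) (fun ω => hb k (ω k))).integrable le_rfl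
  have hmeas : Measurable (∑ k, fun ω : ι → Ω => h k (ω k)) := by
    rw [Finset.sum_fn]
    exact Finset.measurable_sum _ fun k _ => (hm k).comp (measurable_pi_apply k)
  rw [variance_eq_integral hmeas.aemeasurable, hmean] at hv
  simp only [Finset.sum_apply] at hv
  rw [hv]
  exact Finset.sum_le_sum fun k _ =>
    (variance_le_expectation_sq (hm k).aestronglyMeasurable).trans_eq rfl

/-- Real and imaginary parts are treated separately, since the variance is that of real random
variables. -/
theorem integral_pi_norm_sum_sub_sq_le {ι Ω : Type*} [Fintype ι] [MeasurableSpace Ω]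
    (μ : ι → Measure Ω) [∀ k, IsProbabilityMeasure (μ k)] {h : ι → Ω → ℂ}
    (hm : ∀ k, Measurable (h k)) {B : ℝ} (hb : ∀ k x, ‖h k x‖ ≤ B) :
    ∫ ω, ‖∑ k, h k (ω k) - ∑ k, ∫ x, h k x ∂(μ k)‖ ^ 2 ∂(Measure.pi μ) ≤
      ∑ k, ∫ x, ‖h k x‖ ^ 2 ∂(μ k) := by
  have hint : ∀ k, Integrable (h k) (μ k) := fun k =>
    (memLp_of_measurable_of_norm_le (μ k) 1 (hm k) (hb k)).integrable le_rfl
  have hre : ∀ k x, ‖(h k x).re‖ ≤ B := fun k x => (Complex.abs_re_le_norm _).trans (hb k x)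
  have him : ∀ k x, ‖(h k x).im‖ ≤ B := fun k x => (Complex.abs_im_le_norm _).trans (hb k x)
  have mre : ∀ k, Measurable fun x => (h k x).re := fun k => Complex.measurable_re.comp (hm k)
  have mim : ∀ k, Measurable fun x => (h k x).im := fun k => Complex.measurable_im.comp (hm k)
  have h1 := integral_pi_sum_sub_sq_le μ mre hre
  have h2 := integral_pi_sum_sub_sq_le μ mim him
  have r1 : ∀ k, ∫ x, (h k x).re ∂(μ k) = (∫ x, h k x ∂(μ k)).re := fun k => integral_re (hint k)
  have r2 : ∀ k, ∫ x, (h k x).im ∂(μ k) = (∫ x, h k x ∂(μ k)).im := fun k => integral_im (hint k)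
  have sq_int : ∀ (u : ι → Ω → ℝ), (∀ k, Measurable (u k)) → (∀ k x, ‖u k x‖ ≤ B) → ∀ c : ℝ,
      Integrable (fun ω : ι → Ω => (∑ k, u k (ω k) - c) ^ 2) (Measure.pi μ) := by
    intro u hu hB c
    refine (memLp_of_measurable_of_norm_le (Measure.pi μ) 1 (B := (∑ _k : ι, B + ‖c‖) ^ 2)
      ((Finset.measurable_sum _ fun k _ =>
        (hu k).comp (measurable_pi_apply k)).sub_const c |>.pow_const 2) fun ω => ?_).integrable
        le_rfl
    rw [norm_pow]
    refine pow_le_pow_left₀ (norm_nonneg _) ?_ 2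
    exact (norm_sub_le _ _).trans (add_le_add_left
      ((norm_sum_le _ _).trans (Finset.sum_le_sum fun k _ => hB k _)) _)
  have sq_int' : ∀ (u : ι → Ω → ℝ), (∀ k, Measurable (u k)) → (∀ k x, ‖u k x‖ ≤ B) → ∀ k,
      Integrable (fun x => u k x ^ 2) (μ k) := fun u hu hB k =>
    (memLp_of_measurable_of_norm_le (μ k) 1 (B := B ^ 2) ((hu k).pow_const 2) fun x => by
      rw [norm_pow]; exact pow_le_pow_left₀ (norm_nonneg _) (hB k x) 2).integrable le_rfl
  calc _ = ∫ ω, ((∑ k, (h k (ω k)).re - ∑ k, ∫ x, (h k x).re ∂(μ k)) ^ 2 +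
        (∑ k, (h k (ω k)).im - ∑ k, ∫ x, (h k x).im ∂(μ k)) ^ 2) ∂(Measure.pi μ) := by
        refine integral_congr_ae (Filter.Eventually.of_forall fun ω => ?_)
        simp only [r1, r2, ← Complex.normSq_eq_norm_sq, Complex.normSq_apply, Complex.sub_re,
          Complex.sub_im, Complex.re_sum, Complex.im_sum]
        ring
    _ ≤ ∑ k, ∫ x, (h k x).re ^ 2 ∂(μ k) + ∑ k, ∫ x, (h k x).im ^ 2 ∂(μ k) := by
        rw [integral_add (sq_int _ mre hre _) (sq_int _ mim him _)]
        exact add_le_add h1 h2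
    _ = _ := by
        rw [← Finset.sum_add_distrib]
        refine Finset.sum_congr rfl fun k _ => ?_
        rw [← integral_add (sq_int' _ mre hre k) (sq_int' _ mim him k)]
        refine integral_congr_ae (Filter.Eventually.of_forall fun x => ?_)
        simp only [← Complex.normSq_eq_norm_sq, Complex.normSq_apply]
        ring

section Sampling

variable {ι : Type} [Fintype ι] {L κ lam : ℝ} {ρ : (Fin d → ℝ) → ℝ} {f : (Fin d → ℝ) → ℂ}

theorem loss_nonneg (hρ : IsDataDensity L κ ρ) (hL : 0 < L) (hκ : 0 < κ) (hlam : 0 < lam)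
    (ω : ι → Fin d → ℤ) (v : ι → ℂ) : 0 ≤ loss L ρ lam f ω v := by
  have := genError_nonneg hρ hL hκ f (network L ω v)
  unfold loss
  positivity

theorem iInf_loss_le (hρ : IsDataDensity L κ ρ) (hL : 0 < L) (hκ : 0 < κ) (hlam : 0 < lam)
    (ω : ι → Fin d → ℤ) (v : ι → ℂ) : ⨅ w, loss L ρ lam f ω w ≤ loss L ρ lam f ω v :=
  ciInf_le ⟨0, by rintro _ ⟨w, rfl⟩; exact loss_nonneg hρ hL hκ hlam ω w⟩ v

/-- Monte Carlo features with importance weights `a` are an unbiased estimator of `f`. -/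
theorem sum_integral_mul_mode {P : ι → PMF (Fin d → ℤ)} {a : ι → (Fin d → ℤ) → ℂ} {B : ℝ}
    (hf : HasFourierSeries L f) (hB : ∀ k n, ‖a k n‖ ≤ B)
    (ha : ∀ n, ∑ k, ((P k n).toReal : ℂ) * a k n = fourierCoefficient L f n) (x : Fin d → ℝ) :
    ∑ k, ∫ n, a k n * mode L n x ∂(P k).toMeasure = f x := by
  have hb : ∀ k n, ‖a k n * mode L n x‖ ≤ B := fun k n => by
    rw [norm_mul, norm_mode, mul_one]; exact hB k n
  have hint : ∀ k, Integrable (fun n => a k n * mode L n x) (P k).toMeasure := fun k =>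
    (memLp_of_measurable_of_norm_le _ 1 (measurable_of_countable _) (hb k)).integrable le_rfl
  have hsum : ∀ k, Summable fun n => (P k n).toReal • (a k n * mode L n x) := fun k => by
    refine Summable.of_norm_bounded
      ((ENNReal.summable_toReal (P k).tsum_coe_ne_top).mul_right B) fun n => ?_
    rw [norm_smul, Real.norm_of_nonneg ENNReal.toReal_nonneg]
    exact mul_le_mul_of_nonneg_left (hb k n) ENNReal.toReal_nonneg
  simp_rw [fun k => PMF.integral_eq_tsum (P k) _ (hint k)]
  rw [← Summable.tsum_finsetSum fun k _ => hsum k, ← (hf x).tsum_eq]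
  refine tsum_congr fun n => ?_
  rw [← ha n, Finset.sum_mul]
  exact Finset.sum_congr rfl fun k _ => by rw [Complex.real_smul, mul_assoc]

/-- Expected minimal loss for independent frequencies `ω k ∼ P k`, bounded through an unbiased
estimator of `f` with importance weights `a`. -/
theorem lintegral_iInf_loss_le (hρ : IsDataDensity L κ ρ) (hL : 0 < L) (hκ : 0 < κ)
    (hlam : 0 < lam) (hf : HasFourierSeries L f) {P : ι → PMF (Fin d → ℤ)}
    {a : ι → (Fin d → ℤ) → ℂ} {B : ℝ} (hB : ∀ k n, ‖a k n‖ ≤ B)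
    (ha : ∀ n, ∑ k, ((P k n).toReal : ℂ) * a k n = fourierCoefficient L f n) :
    ∫⁻ ω, ENNReal.ofReal (⨅ v, loss L ρ lam f ω v) ∂(Measure.pi fun k => (P k).toMeasure) ≤
      ENNReal.ofReal ((1 + lam) * ∑ k, ∑' n, (P k n).toReal * ‖a k n‖ ^ 2) := by
  have hprob := hρ.isProbabilityMeasure hL hκ
  set Q := Measure.pi fun k => (P k).toMeasure
  set S := ∑' n, ‖fourierCoefficient L f n‖
  let F : (ι → Fin d → ℤ) → (Fin d → ℝ) → ℝ := fun ω x =>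
    ‖network L ω (fun k => a k (ω k)) x - f x‖ ^ 2
  have hFc : ∀ ω, Continuous (F ω) := fun ω =>
    ((continuous_network L ω _).sub hf.continuous).norm.pow 2
  have hFm : Measurable (Function.uncurry F) :=
    measurable_from_prod_countable_right fun ω => (hFc ω).measurable
  have hFb : ∀ ω x, ‖F ω x‖ ≤ (∑ _k : ι, B + S) ^ 2 := fun ω x => by
    rw [norm_pow, norm_norm]
    refine pow_le_pow_left₀ (norm_nonneg _) ((norm_sub_le _ _).trans
      (add_le_add ((norm_sum_le _ _).trans (Finset.sum_le_sum fun k _ => ?_)) (hf.norm_le x))) 2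
    rw [norm_mul, norm_mode, mul_one]; exact hB k _
  have hFint : Integrable (Function.uncurry F) (Q.prod (dataMeasure L ρ)) :=
    (memLp_of_measurable_of_norm_le _ 1 hFm fun z => hFb z.1 z.2).integrable le_rfl
  have hG : ∀ ω, genError L ρ f (network L ω fun k => a k (ω k)) =
      ∫ x, F ω x ∂(dataMeasure L ρ) := fun ω => genError_eq_integral hρ hL hκ _ _
  have hGint : Integrable (fun ω => genError L ρ f (network L ω fun k => a k (ω k))) Q := by
    simp_rw [hG]; exact hFint.integral_prod_left
  have hRint : ∀ k, Integrable (fun n => ‖a k n‖ ^ 2) (P k).toMeasure := fun k =>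
    (memLp_of_measurable_of_norm_le _ 1 (B := B ^ 2) (measurable_of_countable _) fun n => by
      rw [norm_pow, norm_norm]
      exact pow_le_pow_left₀ (norm_nonneg _) (hB k n) 2).integrable le_rfl
  have hRint' : ∀ k, Integrable (fun ω : ι → Fin d → ℤ => ‖a k (ω k)‖ ^ 2) Q := fun k =>
    (measurePreserving_eval (fun k => (P k).toMeasure) k).integrable_comp_of_integrable (hRint k)
  -- After Fubini the variance bound applies at each fixed `x`, where the estimator has mean `f x`;
  -- its bound does not depend on `x`.
  have hgen : ∫ ω, genError L ρ f (network L ω fun k => a k (ω k)) ∂Q ≤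
      ∑ k, ∫ n, ‖a k n‖ ^ 2 ∂(P k).toMeasure := by
    simp_rw [hG]
    rw [integral_integral_swap hFint]
    calc _ ≤ ∫ x, (∑ k, ∫ n, ‖a k n‖ ^ 2 ∂(P k).toMeasure) ∂(dataMeasure L ρ) := by
          refine integral_mono hFint.integral_prod_right (integrable_const _) fun x => ?_
          have := integral_pi_norm_sum_sub_sq_le (fun k => (P k).toMeasure)
            (h := fun k n => a k n * mode L n x) (fun k => measurable_of_countable _) (B := B)
            fun k n => by rw [norm_mul, norm_mode, mul_one]; exact hB k n
          rw [sum_integral_mul_mode hf hB ha x] at this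
          simp only [norm_mul, norm_mode, mul_one] at this
          exact this
      _ = _ := by simp
  have hreg : ∫ ω, lam * ∑ k, ‖a k (ω k)‖ ^ 2 ∂Q =
      lam * ∑ k, ∫ n, ‖a k n‖ ^ 2 ∂(P k).toMeasure := by
    rw [integral_const_mul, integral_finsetSum _ fun k _ => hRint' k]
    congr 1
    refine Finset.sum_congr rfl fun k _ => ?_
    exact integral_comp_eval (μ := fun k => (P k).toMeasure) (i := k)
      (measurable_of_countable fun n => ‖a k n‖ ^ 2).aestronglyMeasurable
  calc _ ≤ ∫⁻ ω, ENNReal.ofReal (loss L ρ lam f ω fun k => a k (ω k)) ∂Q :=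
        lintegral_mono fun ω => ENNReal.ofReal_le_ofReal (iInf_loss_le hρ hL hκ hlam ω _)
    _ = ENNReal.ofReal (∫ ω, loss L ρ lam f ω (fun k => a k (ω k)) ∂Q) := by
        refine (ofReal_integral_eq_lintegral_ofReal ?_ (Filter.Eventually.of_forall fun ω =>
          loss_nonneg hρ hL hκ hlam ω _)).symm
        exact hGint.add ((integrable_finsetSum _ fun k _ => hRint' k).const_mul lam)
    _ ≤ _ := by
        refine ENNReal.ofReal_le_ofReal ?_
        unfold loss
        rw [integral_add hGint ((integrable_finsetSum _ fun k _ => hRint' k).const_mul lam), hreg]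
        simp_rw [← smul_eq_mul (ENNReal.toReal _), ← fun k => PMF.integral_eq_tsum (P k) _ (hRint k)]
        linarith

end Sampling

/-! ### Counting lattice points and the tail of the coefficients. -/

theorem abs_le_latticeNorm (n : Fin d → ℤ) (i : Fin d) : |(n i : ℝ)| ≤ latticeNorm n := by
  unfold latticeNorm
  rw [← Real.sqrt_sq_eq_abs]
  exact Real.sqrt_le_sqrt
    (Finset.single_le_sum (f := fun j => (n j : ℝ) ^ 2) (fun j _ => sq_nonneg _)
      (Finset.mem_univ i))

theorem one_le_latticeNorm {n : Fin d → ℤ} (hn : n ≠ 0) : 1 ≤ latticeNorm n := by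
  obtain ⟨i, hi⟩ := Function.ne_iff.1 hn
  refine le_trans ?_ (abs_le_latticeNorm n i)
  exact_mod_cast Int.one_le_abs hi

section Decay

variable {L c C ℓ : ℝ} {f : (Fin d → ℝ) → ℂ}

theorem HasDecay.latticeNorm_le (hf : HasDecay L c C ℓ f) (hC : 0 < C) (hℓ : 0 < ℓ) {u : ℝ}
    (hu : 0 < u) {n : Fin d → ℤ} (hn : n ≠ 0) (h : u ≤ ‖fourierCoefficient L f n‖) :
    latticeNorm n ≤ C * u ^ (-(1 / ℓ)) := by
  have h1 := one_le_latticeNorm hn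
  have h2 : u ^ (1 / ℓ) ≤ C / latticeNorm n := by
    have := Real.rpow_le_rpow hu.le (h.trans (hf n hn).2) (z := 1 / ℓ) (by positivity)
    rwa [← Real.rpow_mul (by positivity), mul_one_div_cancel hℓ.ne', Real.rpow_one] at this
  rw [Real.rpow_neg hu.le]
  have h3 : 0 < u ^ (1 / ℓ) := by positivity
  rw [le_div_iff₀ (by linarith)] at h2
  rw [← div_eq_mul_inv, le_div_iff₀ h3]
  linarith

/-- Such points lie in a cube of side `2⌊R⌋ + 1`, at most `3R` once `R ≥ 1`, and any one of them
forces `R ≥ 1`. The origin is left out because the decay says nothing about it. -/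
theorem HasDecay.encard_le (hf : HasDecay L c C ℓ f) (hC : 0 < C) (hℓ : 0 < ℓ) {u : ℝ}
    (hu : 0 < u) :
    ∑' n : Fin d → ℤ, (if n ≠ 0 ∧ u ≤ ‖fourierCoefficient L f n‖ then (1 : ℝ≥0∞) else 0) ≤
      ENNReal.ofReal ((3 * C) ^ d * u ^ (-(d / ℓ))) := by
  set R := C * u ^ (-(1 / ℓ)) with hR
  by_cases hne : ∃ n : Fin d → ℤ, n ≠ 0 ∧ u ≤ ‖fourierCoefficient L f n‖
  · obtain ⟨n₀, hn₀, hu₀⟩ := hne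
    have hR1 : 1 ≤ R := (one_le_latticeNorm hn₀).trans (hf.latticeNorm_le hC hℓ hu hn₀ hu₀)
    set B : Finset (Fin d → ℤ) := Fintype.piFinset fun _ => Finset.Icc (-⌊R⌋) ⌊R⌋ with hB
    have hzero : ∀ n ∉ B,
        (if n ≠ 0 ∧ u ≤ ‖fourierCoefficient L f n‖ then (1 : ℝ≥0∞) else 0) = 0 := by
      intro n hn
      refine if_neg fun ⟨h0, h1⟩ => hn ?_
      have h2 := hf.latticeNorm_le hC hℓ hu h0 h1
      refine Fintype.mem_piFinset.2 fun i => ?_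
      have h3 := abs_le.1 ((abs_le_latticeNorm n i).trans h2)
      rw [Finset.mem_Icc, neg_le, Int.le_floor, Int.le_floor]
      push_cast
      exact ⟨by linarith [h3.1], h3.2⟩
    have hfl : (1 : ℤ) ≤ ⌊R⌋ := Int.le_floor.2 (by exact_mod_cast hR1)
    have hcard : (B.card : ℝ) ≤ (3 * C) ^ d * u ^ (-(d / ℓ)) := by
      have h4 : (3 * C) ^ d * u ^ (-(d / ℓ)) = (3 * R) ^ d := by
        rw [hR, ← mul_assoc, mul_pow _ (u ^ _), ← Real.rpow_natCast (u ^ _),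
          ← Real.rpow_mul hu.le]
        congr 2
        ring
      rw [h4, hB, Fintype.card_piFinset_const, Int.card_Icc]
      push_cast
      refine pow_le_pow_left₀ (by positivity) ?_ d
      have h5 : (((⌊R⌋ + 1 - -⌊R⌋).toNat : ℤ) : ℝ) = 2 * ⌊R⌋ + 1 := by
        rw [Int.toNat_of_nonneg (by linarith)]; push_cast; ring
      have h6 := Int.floor_le R
      rw [← Int.cast_natCast, h5]
      linarith
    rw [tsum_eq_sum hzero]
    calc _ ≤ ∑ _n ∈ B, (1 : ℝ≥0∞) := Finset.sum_le_sum fun n _ => by split_ifs <;> simp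
      _ = ENNReal.ofReal B.card := by simp
      _ ≤ _ := ENNReal.ofReal_le_ofReal hcard
  · push Not at hne
    rw [ENNReal.tsum_eq_zero.2 fun n => if_neg fun h => absurd h.2 (not_le.2 (hne n h.1))]
    exact zero_le

/-- The total size of the Fourier coefficients below a threshold `t`. -/
theorem HasDecay.tsum_small_le (hf : HasDecay L c C ℓ f) (hfs : HasFourierSeries L f) (hC : 0 < C)
    (hd : 0 < d) (hℓ : (d : ℝ) < ℓ) {t : ℝ} (ht : 0 < t) :
    ∑' n : Fin d → ℤ, (if ‖fourierCoefficient L f n‖ < t then ‖fourierCoefficient L f n‖ else 0) ≤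
      t + (3 * C) ^ d * (t ^ (1 - d / ℓ) / (1 - d / ℓ)) := by
  have hd' : (0 : ℝ) < d := by exact_mod_cast hd
  have hℓ0 : 0 < ℓ := hd'.trans hℓ
  have hs : d / ℓ < 1 := (div_lt_one hℓ0).2 hℓ
  have hnn : ∀ n : Fin d → ℤ, 0 ≤
      (if ‖fourierCoefficient L f n‖ < t then ‖fourierCoefficient L f n‖ else 0) := fun n => by
    split_ifs <;> positivity
  have hsum : Summable fun n : Fin d → ℤ =>
      (if ‖fourierCoefficient L f n‖ < t then ‖fourierCoefficient L f n‖ else 0) :=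
    Summable.of_nonneg_of_le hnn (fun n => by split_ifs <;> simp) hfs.summable_norm
  have hpos : 0 ≤ (3 * C) ^ d * (t ^ (1 - d / ℓ) / (1 - d / ℓ)) := by
    have : 0 < 1 - d / ℓ := by linarith
    positivity
  rw [← ENNReal.ofReal_le_ofReal_iff (by positivity), ENNReal.ofReal_tsum_of_nonneg hnn hsum]
  -- Layer cake: a modulus below `t` is the length of the set of levels `u` in `(0, t]` that it
  -- reaches. The origin is charged `t` outright.
  have hterm : ∀ n : Fin d → ℤ, ENNReal.ofReal
      (if ‖fourierCoefficient L f n‖ < t then ‖fourierCoefficient L f n‖ else 0) ≤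
      (if n = 0 then ENNReal.ofReal t else 0) + ∫⁻ u in Set.Ioc 0 t,
        (if n ≠ 0 ∧ u ≤ ‖fourierCoefficient L f n‖ then (1 : ℝ≥0∞) else 0) := by
    intro n
    split_ifs with h h0 h0
    · exact (ENNReal.ofReal_le_ofReal h.le).trans le_self_add
    · have hi : (fun u => if n ≠ 0 ∧ u ≤ ‖fourierCoefficient L f n‖ then (1 : ℝ≥0∞) else 0) =
          (Set.Iic ‖fourierCoefficient L f n‖).indicator 1 := by
        funext u; simp [Set.indicator, h0]
      rw [hi, lintegral_indicator_one measurableSet_Iic, Measure.restrict_apply measurableSet_Iic,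
        zero_add, Set.inter_comm, Set.Ioc_inter_Iic, inf_eq_right.2 h.le, Real.volume_Ioc, sub_zero]
    · simp
    · simp
  have hint : IntegrableOn (fun u : ℝ => (3 * C) ^ d * u ^ (-(d / ℓ))) (Set.Ioc 0 t) := by
    refine Integrable.const_mul ?_ _
    rw [← IntegrableOn, ← intervalIntegrable_iff_integrableOn_Ioc_of_le ht.le]
    exact intervalIntegral.intervalIntegrable_rpow' (by linarith)
  calc _ ≤ ∑' n : Fin d → ℤ, ((if n = 0 then ENNReal.ofReal t else 0) + ∫⁻ u in Set.Ioc 0 t,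
        (if n ≠ 0 ∧ u ≤ ‖fourierCoefficient L f n‖ then (1 : ℝ≥0∞) else 0)) :=
        ENNReal.tsum_le_tsum hterm
    _ = ENNReal.ofReal t + ∫⁻ u in Set.Ioc 0 t, ∑' n : Fin d → ℤ,
        (if n ≠ 0 ∧ u ≤ ‖fourierCoefficient L f n‖ then (1 : ℝ≥0∞) else 0) := by
        rw [ENNReal.tsum_add, tsum_ite_eq, lintegral_tsum]
        intro n
        refine (Measurable.ite ?_ measurable_const measurable_const).aemeasurable
        exact (MeasurableSet.const (n ≠ 0)).inter
          (measurableSet_Iic (a := ‖fourierCoefficient L f n‖))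
    _ ≤ ENNReal.ofReal t + ∫⁻ u in Set.Ioc 0 t,
        ENNReal.ofReal ((3 * C) ^ d * u ^ (-(d / ℓ))) := by
        refine add_le_add le_rfl (setLIntegral_mono' measurableSet_Ioc fun u hu => ?_)
        exact hf.encard_le hC hℓ0 hu.1
    _ = _ := by
        rw [← ofReal_integral_eq_lintegral_ofReal hint, ← ENNReal.ofReal_add ht.le,
          integral_const_mul, ← intervalIntegral.integral_of_le ht.le, integral_rpow
            (Or.inl (by linarith)), Real.zero_rpow (by linarith), sub_zero, neg_add_eq_sub]
        · refine integral_nonneg_of_ae ((ae_restrict_iff' measurableSet_Ioc).2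
            (Filter.Eventually.of_forall fun u hu => ?_))
          have := hu.1
          simp only [Pi.zero_apply]
          positivity
        · refine (ae_restrict_iff' measurableSet_Ioc).2 (Filter.Eventually.of_forall fun u hu => ?_)
          have := hu.1
          simp only [Pi.zero_apply]
          positivity

/-- A unit lattice vector already gives this. The bound is independent of `f`, so `M` may contain
inverse powers of it. -/
theorem HasDecay.rpow_le_tsum_norm (hf : HasDecay L c C ℓ f) (hfs : HasFourierSeries L f)
    (hd : 0 < d) : c ^ ℓ ≤ ∑' n, ‖fourierCoefficient L f n‖ := by
  let i : Fin d := ⟨0, hd⟩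
  have hn : (Pi.single i 1 : Fin d → ℤ) ≠ 0 := by simp
  have hnorm : latticeNorm (Pi.single i 1 : Fin d → ℤ) = 1 := by
    unfold latticeNorm
    rw [Finset.sum_eq_single i] <;> simp +contextual
  have := (hf _ hn).1
  rw [hnorm, div_one] at this
  exact this.trans (hfs.summable_norm.le_tsum _ fun j _ => norm_nonneg _)

end Decay

/-! ### Optimality of the rate constant. -/

section RateConstant

variable {L : ℝ} {f : (Fin d → ℝ) → ℂ}

/-- Summing `2 S a ≤ a² / p + S² p` over all modes, with `∑ p = 1`, gives `2 S² ≤ C_p + S²`. -/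
theorem le_rateConstant (hf : HasFourierSeries L f) (p : PMF (Fin d → ℤ)) :
    ENNReal.ofReal ((∑' n, ‖fourierCoefficient L f n‖) ^ 2) ≤ rateConstant L f p := by
  set S := ∑' n, ‖fourierCoefficient L f n‖ with hS
  have hS0 : 0 ≤ S := tsum_nonneg fun n => norm_nonneg _
  have hterm : ∀ n, 2 * ENNReal.ofReal S * ‖fourierCoefficient L f n‖ₑ ≤
      ‖fourierCoefficient L f n‖ₑ ^ 2 / p n + ENNReal.ofReal S ^ 2 * p n := by
    intro n
    rcases eq_or_ne (fourierCoefficient L f n) 0 with h0 | h0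
    · simp [h0]
    rcases eq_or_ne (p n) 0 with hp | hp
    · rw [hp, ENNReal.div_zero (by simpa using h0)]; simp
    have hpt := p.apply_ne_top n
    have hp0 : 0 < (p n).toReal := ENNReal.toReal_pos hp hpt
    rw [← ENNReal.ofReal_toReal hpt, ← ofReal_norm, ← ENNReal.ofReal_pow (norm_nonneg _),
      ← ENNReal.ofReal_pow hS0, ← ENNReal.ofReal_div_of_pos hp0,
      ← ENNReal.ofReal_mul (by positivity), ← ENNReal.ofReal_add (by positivity) (by positivity),
      ← ENNReal.ofReal_ofNat 2, ← ENNReal.ofReal_mul (by positivity),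
      ← ENNReal.ofReal_mul (by positivity)]
    refine ENNReal.ofReal_le_ofReal ?_
    set a := ‖fourierCoefficient L f n‖
    set b := (p n).toReal
    have : a ^ 2 / b + S ^ 2 * b - 2 * S * a = (a - S * b) ^ 2 / b := by
      field_simp
      ring
    have : 0 ≤ (a - S * b) ^ 2 / b := by positivity
    linarith
  have hsum := ENNReal.tsum_le_tsum hterm
  have hSe : ∑' n, ‖fourierCoefficient L f n‖ₑ = ENNReal.ofReal S := by
    rw [hS, ENNReal.ofReal_tsum_of_nonneg (fun n => norm_nonneg _) hf.summable_norm]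
    simp_rw [ofReal_norm]
  rw [ENNReal.tsum_mul_left, hSe, ENNReal.tsum_add, ENNReal.tsum_mul_left, p.tsum_coe, mul_one,
    mul_assoc, ← sq, two_mul] at hsum
  rw [ENNReal.ofReal_pow hS0]
  exact (ENNReal.add_le_add_iff_right (by simp)).1 hsum

/-- The minimum is attained by the distribution proportional to the moduli of the coefficients. -/
theorem isLeast_rateConstant (hf : HasFourierSeries L f)
    (hS : 0 < ∑' n, ‖fourierCoefficient L f n‖) :
    IsLeast (Set.range (rateConstant L f))
      (ENNReal.ofReal ((∑' n, ‖fourierCoefficient L f n‖) ^ 2)) := by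
  refine ⟨?_, by rintro _ ⟨p, rfl⟩; exact le_rateConstant hf p⟩
  have hSe : ∑' n, ‖fourierCoefficient L f n‖ₑ =
      ENNReal.ofReal (∑' n, ‖fourierCoefficient L f n‖) := by
    rw [ENNReal.ofReal_tsum_of_nonneg (fun n => norm_nonneg _) hf.summable_norm]
    simp_rw [ofReal_norm]
  have h0 : ∑' n, ‖fourierCoefficient L f n‖ₑ ≠ 0 := by
    rw [hSe]; simpa using hS
  have ht : ∑' n, ‖fourierCoefficient L f n‖ₑ ≠ ∞ := by rw [hSe]; simp
  refine ⟨PMF.normalize _ h0 ht, ?_⟩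
  unfold rateConstant
  simp_rw [PMF.normalize_apply]
  rw [ENNReal.ofReal_pow hS.le, ← hSe]
  set T := ∑' n, ‖fourierCoefficient L f n‖ₑ with hT
  have hterm : ∀ n, ‖fourierCoefficient L f n‖ₑ ^ 2 / (‖fourierCoefficient L f n‖ₑ * T⁻¹) =
      ‖fourierCoefficient L f n‖ₑ * T := by
    intro n
    rcases eq_or_ne ‖fourierCoefficient L f n‖ₑ 0 with hn | hn
    · simp [hn]
    · rw [sq, ENNReal.mul_div_mul_left _ _ hn (by simp), div_eq_mul_inv, inv_inv]
  simp_rw [hterm]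
  rw [ENNReal.tsum_mul_right, sq]

end RateConstant

/-! ### Importance weights for frequencies drawn from `p`. -/

section Importance

variable {L lam C'' : ℝ} {f : (Fin d → ℝ) → ℂ} {p : PMF (Fin d → ℤ)}

/-- `ENNReal.ofReal` sends negative numbers to zero, hence `max C'' 0`. -/
theorem norm_fourierCoefficient_le_mul
    (h : (⨆ n, ‖fourierCoefficient L f n‖ₑ / p n) ≤ ENNReal.ofReal C'') (n : Fin d → ℤ) :
    ‖fourierCoefficient L f n‖ ≤ max C'' 0 * (p n).toReal := by
  have h1 := (le_iSup (fun n => ‖fourierCoefficient L f n‖ₑ / p n) n).trans h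
  rcases eq_or_ne (p n) 0 with hp | hp
  · rcases eq_or_ne (fourierCoefficient L f n) 0 with h0 | h0
    · simp [h0, hp]
    · rw [hp, ENNReal.div_zero (by simpa using h0)] at h1
      simp at h1
  · rw [ENNReal.div_le_iff hp (p.apply_ne_top n)] at h1
    have h2 := ENNReal.toReal_mono (ENNReal.mul_ne_top (by simp) (p.apply_ne_top n)) h1
    rwa [ENNReal.toReal_mul, toReal_enorm, ENNReal.toReal_ofReal'] at h2

theorem tsum_norm_fourierCoefficient_le (hf : HasFourierSeries L f)
    (hp : ∀ n, ‖fourierCoefficient L f n‖ ≤ C'' * (p n).toReal) :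
    ∑' n, ‖fourierCoefficient L f n‖ ≤ C'' := by
  have hs := ENNReal.summable_toReal p.tsum_coe_ne_top
  refine (hf.summable_norm.tsum_le_tsum hp (hs.mul_left C'')).trans_eq ?_
  rw [tsum_mul_left, ← ENNReal.tsum_toReal_eq p.apply_ne_top, p.tsum_coe, ENNReal.toReal_one,
    mul_one]

/-- Where `p` vanishes the coefficient vanishes too, so the convention for division by zero causes
no bias. -/
theorem toReal_mul_importance
    (hp : ∀ n, ‖fourierCoefficient L f n‖ ≤ C'' * (p n).toReal) {N : ℝ} (hN : N ≠ 0)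
    (n : Fin d → ℤ) :
    N * (((p n).toReal : ℂ) * (fourierCoefficient L f n / (N * (p n).toReal : ℝ))) =
      fourierCoefficient L f n := by
  rcases eq_or_ne (p n).toReal 0 with h | h
  · have := hp n
    rw [h, mul_zero, norm_le_zero_iff] at this
    simp [this]
  · have hN' : (N : ℂ) ≠ 0 := by exact_mod_cast hN
    have h' : ((p n).toReal : ℂ) ≠ 0 := by exact_mod_cast h
    push_cast
    field_simp

theorem norm_importance_le (hC : 0 ≤ C'')
    (hp : ∀ n, ‖fourierCoefficient L f n‖ ≤ C'' * (p n).toReal) {N : ℝ} (hN : 0 < N)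
    (n : Fin d → ℤ) :
    ‖fourierCoefficient L f n / (N * (p n).toReal : ℝ)‖ ≤ C'' / N := by
  rcases eq_or_ne (p n).toReal 0 with h | h
  · simp only [h, mul_zero, Complex.ofReal_zero, div_zero, norm_zero]; positivity
  · have h0 : 0 < (p n).toReal := lt_of_le_of_ne ENNReal.toReal_nonneg h.symm
    rw [norm_div, Complex.norm_real, Real.norm_of_nonneg (by positivity),
      div_le_div_iff₀ (by positivity) hN]
    nlinarith [hp n]

/-- Linear, not quadratic, in the modulus: bounding one factor uniformly by `C'' / N` makes
discarded modes count by their total modulus. -/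
theorem toReal_mul_norm_importance_sq_le (hC : 0 ≤ C'')
    (hp : ∀ n, ‖fourierCoefficient L f n‖ ≤ C'' * (p n).toReal) {N : ℝ} (hN : 0 < N)
    (n : Fin d → ℤ) :
    (p n).toReal * ‖fourierCoefficient L f n / (N * (p n).toReal : ℝ)‖ ^ 2 ≤
      C'' / N ^ 2 * ‖fourierCoefficient L f n‖ := by
  rcases eq_or_ne (p n).toReal 0 with h | h
  · rw [h, zero_mul]; positivity
  · have h0 : 0 < (p n).toReal := lt_of_le_of_ne ENNReal.toReal_nonneg h.symm
    have h1 := norm_importance_le hC hp hN n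
    have h2 : (p n).toReal * ‖fourierCoefficient L f n / (N * (p n).toReal : ℝ)‖ =
        ‖fourierCoefficient L f n‖ / N := by
      rw [norm_div, Complex.norm_real, Real.norm_of_nonneg (by positivity)]
      field_simp
    calc _ = (‖fourierCoefficient L f n‖ / N) *
          ‖fourierCoefficient L f n / (N * (p n).toReal : ℝ)‖ := by rw [← h2]; ring
      _ ≤ (‖fourierCoefficient L f n‖ / N) * (C'' / N) :=
          mul_le_mul_of_nonneg_left h1 (by positivity)
      _ = _ := by field_simp

/-- Expected minimal loss for `K` independent frequencies from `p`. -/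
theorem lintegral_iInf_loss_seed_le {κ : ℝ} {ρ : (Fin d → ℝ) → ℝ} {K : ℕ}
    (hρ : IsDataDensity L κ ρ) (hL : 0 < L) (hκ : 0 < κ)
    (hlam : 0 < lam) (hf : HasFourierSeries L f) (hK : 0 < K) (hC : 0 ≤ C'')
    (hp : ∀ n, ‖fourierCoefficient L f n‖ ≤ C'' * (p n).toReal) :
    ∫⁻ ν : Fin K → Fin d → ℤ, ENNReal.ofReal (⨅ v, loss L ρ lam f ν v)
        ∂(Measure.pi fun _ => p.toMeasure) ≤
      ENNReal.ofReal ((1 + lam) * (C'' / K * ∑' n, ‖fourierCoefficient L f n‖)) := by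
  have hK' : (0 : ℝ) < K := by exact_mod_cast hK
  refine (lintegral_iInf_loss_le (P := fun _ => p)
    (a := fun _ n => fourierCoefficient L f n / (K * (p n).toReal : ℝ)) hρ hL hκ hlam hf
    (fun _ n => norm_importance_le hC hp hK' n) fun n => ?_).trans (ENNReal.ofReal_le_ofReal ?_)
  · have := toReal_mul_importance hp hK'.ne' n
    rw [Finset.sum_const, Finset.card_univ, Fintype.card_fin, nsmul_eq_mul]
    exact_mod_cast this
  · rw [Finset.sum_const, Finset.card_univ, Fintype.card_fin, nsmul_eq_mul]
    refine mul_le_mul_of_nonneg_left ?_ (by linarith)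
    have hs := hf.summable_norm.mul_left (C'' / (K : ℝ) ^ 2)
    have hle := fun n => toReal_mul_norm_importance_sq_le hC hp hK' n
    have := (Summable.of_nonneg_of_le (fun n => by positivity) hle hs).tsum_le_tsum hle hs
    rw [tsum_mul_left] at this
    calc _ ≤ (K : ℝ) * (C'' / (K : ℝ) ^ 2 * ∑' n, ‖fourierCoefficient L f n‖) :=
          mul_le_mul_of_nonneg_left this hK'.le
      _ = _ := by field_simp

end Importance

/-! ### The resampling step for a fixed seed sample. -/

section Resampling

variable {K : ℕ} {ε : ℝ} {ν : Fin K → Fin d → ℤ} {b : Fin K → ℂ}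

/-- The lattice points whose combined amplitude survives the cutoff. -/
noncomputable def survivors (ε : ℝ) (ν : Fin K → Fin d → ℤ) (b : Fin K → ℂ) :
    Finset (Fin d → ℤ) :=
  (Finset.univ.image ν).filter fun n => ε ≤ ‖combinedAmplitude ν b n‖

theorem mem_survivors (hε : 0 < ε) {n : Fin d → ℤ} :
    n ∈ survivors ε ν b ↔ ε ≤ ‖combinedAmplitude ν b n‖ := by
  unfold survivors
  rw [Finset.mem_filter, and_iff_right_iff_imp]
  intro h
  by_contra hn
  have h0 : combinedAmplitude ν b n = 0 := by
    unfold combinedAmplitude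
    rw [Finset.filter_false_of_mem, Finset.sum_empty]
    intro k _ hk
    exact hn (Finset.mem_image.2 ⟨k, Finset.mem_univ k, hk⟩)
  rw [h0, norm_zero] at h
  linarith

theorem cutoffWeight_of_mem (hε : 0 < ε) {n : Fin d → ℤ} (hn : n ∈ survivors ε ν b) :
    cutoffWeight ε ν b n = ‖combinedAmplitude ν b n‖ₑ := by
  rw [mem_survivors hε] at hn
  simp [cutoffWeight, Set.indicator, hn]

theorem cutoffWeight_of_notMem (hε : 0 < ε) {n : Fin d → ℤ} (hn : n ∉ survivors ε ν b) :
    cutoffWeight ε ν b n = 0 := by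
  rw [mem_survivors hε] at hn
  simp [cutoffWeight, Set.indicator, hn]

theorem tsum_cutoffWeight (hε : 0 < ε) :
    ∑' n, cutoffWeight ε ν b n =
      ENNReal.ofReal (∑ n ∈ survivors ε ν b, ‖combinedAmplitude ν b n‖) := by
  rw [tsum_eq_sum (s := survivors ε ν b), ENNReal.ofReal_sum_of_nonneg fun _ _ => norm_nonneg _]
  · refine Finset.sum_congr rfl fun n hn => ?_
    rw [cutoffWeight_of_mem hε hn, ofReal_norm]
  · exact fun n hn => cutoffWeight_of_notMem hε hn

theorem toReal_resampleDist (r : PMF (Fin d → ℤ)) (hε : 0 < ε) {n : Fin d → ℤ}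
    (hn : n ∈ survivors ε ν b) :
    (resampleDist r ε ν b n).toReal =
      ‖combinedAmplitude ν b n‖ / ∑ m ∈ survivors ε ν b, ‖combinedAmplitude ν b m‖ := by
  have hpos : 0 < ∑ m ∈ survivors ε ν b, ‖combinedAmplitude ν b m‖ :=
    Finset.sum_pos (fun m hm => hε.trans_le ((mem_survivors hε).1 hm)) ⟨n, hn⟩
  have hne : ∑' n, cutoffWeight ε ν b n ≠ 0 := by
    rw [tsum_cutoffWeight hε]; simpa using hpos
  rw [resampleDist, dif_pos hne, PMF.normalize_apply, tsum_cutoffWeight hε,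
    cutoffWeight_of_mem hε hn, ENNReal.toReal_mul, toReal_enorm,
    ENNReal.toReal_inv, ENNReal.toReal_ofReal hpos.le, div_eq_mul_inv]

theorem sum_norm_combinedAmplitude_le (F : Finset (Fin d → ℤ)) :
    ∑ n ∈ F, ‖combinedAmplitude ν b n‖ ≤ ∑ k, ‖b k‖ := by
  calc _ ≤ ∑ n ∈ F, ∑ k with ν k = n, ‖b k‖ := Finset.sum_le_sum fun n _ => norm_sum_le _ _
    _ = ∑ k with ν k ∈ F, ‖b k‖ := by
      simp_rw [Finset.sum_filter]
      rw [Finset.sum_comm]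
      exact Finset.sum_congr rfl fun k _ => Finset.sum_ite_eq F (ν k) fun _ => ‖b k‖
    _ ≤ _ := Finset.sum_le_sum_of_subset_of_nonneg (Finset.filter_subset _ _)
      fun _ _ _ => norm_nonneg _

theorem sum_norm_combinedAmplitude_le_sqrt (F : Finset (Fin d → ℤ)) :
    ∑ n ∈ F, ‖combinedAmplitude ν b n‖ ≤ √K * √(∑ k, ‖b k‖ ^ 2) := by
  refine (sum_norm_combinedAmplitude_le F).trans ?_
  rw [← Real.sqrt_mul (by positivity)]
  refine Real.le_sqrt_of_sq_le ?_
  have := sq_sum_le_card_mul_sum_sq (s := Finset.univ) (f := fun k => ‖b k‖)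
  simpa using this

variable {L κ lam C'' : ℝ} {ρ : (Fin d → ℝ) → ℝ} {f : (Fin d → ℝ) → ℂ}

theorem weight_mul_sq {N w Z : ℝ} (hN : N ≠ 0) (hw : w ≠ 0) (hZ : Z ≠ 0) (x : ℝ) :
    N * (w / Z * (x * (Z / (N * w))) ^ 2) = Z / N * (x ^ 2 / w) := by
  field_simp

/-- Stratified estimator: `a₁` is supported on the survivors and `a₂` off them, so each mode is
estimated without bias by exactly one kind of draw. -/
theorem lintegral_iInf_loss_resample_le {K₁ K₂ : ℕ} {p r : PMF (Fin d → ℤ)}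
    {β : (Fin K → Fin d → ℤ) → Fin K → ℂ} (hρ : IsDataDensity L κ ρ) (hL : 0 < L) (hκ : 0 < κ)
    (hlam : 0 < lam) (hf : HasFourierSeries L f) (hC : 0 ≤ C'')
    (hp : ∀ n, ‖fourierCoefficient L f n‖ ≤ C'' * (p n).toReal) (hε : 0 < ε) (hK₁ : 0 < K₁)
    (hK₂ : 0 < K₂) (ν : Fin K → Fin d → ℤ) :
    ∫⁻ ω, ENNReal.ofReal (⨅ v, loss L ρ lam f ω v) ∂(resampleKernel p r ε β K₁ K₂ ν) ≤
      ENNReal.ofReal ((1 + lam) *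
        ((∑ n ∈ survivors ε ν (β ν), ‖combinedAmplitude ν (β ν) n‖) / K₁ *
          (∑ n ∈ survivors ε ν (β ν),
            ‖fourierCoefficient L f n‖ ^ 2 / ‖combinedAmplitude ν (β ν) n‖) +
        C'' / K₂ * ∑' n, if n ∈ survivors ε ν (β ν) then 0 else ‖fourierCoefficient L f n‖)) := by
  have hK₁' : (0 : ℝ) < K₁ := by exact_mod_cast hK₁
  have hK₂' : (0 : ℝ) < K₂ := by exact_mod_cast hK₂
  set G := survivors ε ν (β ν)
  set w : (Fin d → ℤ) → ℝ := fun n => ‖combinedAmplitude ν (β ν) n‖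
  set Z := ∑ n ∈ G, w n
  set a₁ : (Fin d → ℤ) → ℂ := fun n =>
    if n ∈ G then fourierCoefficient L f n * (Z / (K₁ * w n) : ℝ) else 0 with ha₁
  set a₂ : (Fin d → ℤ) → ℂ := fun n =>
    if n ∈ G then 0 else fourierCoefficient L f n / (K₂ * (p n).toReal : ℝ) with ha₂
  have hw : ∀ n ∈ G, 0 < w n := fun n hn => hε.trans_le ((mem_survivors hε).1 hn)
  have hZ : ∀ n ∈ G, 0 < Z := fun n hn => Finset.sum_pos hw ⟨n, hn⟩
  have hr : ∀ n ∈ G, (resampleDist r ε ν (β ν) n).toReal = w n / Z := fun n hn =>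
    toReal_resampleDist r hε hn
  have hB₁ : ∀ n, ‖a₁ n‖ ≤ ∑ m ∈ G, ‖a₁ m‖ := fun n => by
    by_cases hn : n ∈ G
    · exact Finset.single_le_sum (f := fun m => ‖a₁ m‖) (fun _ _ => norm_nonneg _) hn
    · rw [ha₁]; simp only [if_neg hn, norm_zero]
      exact Finset.sum_nonneg fun _ _ => norm_nonneg _
  have hB₂ : ∀ n, ‖a₂ n‖ ≤ C'' / K₂ := fun n => by
    rw [ha₂]; dsimp only
    split_ifs
    · rw [norm_zero]; positivity
    · exact norm_importance_le hC hp hK₂' n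
  clear_value Z G
  refine (lintegral_iInf_loss_le
    (P := Sum.elim (fun _ : Fin K₁ => resampleDist r ε ν (β ν)) (fun _ : Fin K₂ => p))
    (a := Sum.elim (fun _ : Fin K₁ => a₁) (fun _ : Fin K₂ => a₂))
    (B := max (∑ m ∈ G, ‖a₁ m‖) (C'' / K₂)) hρ hL hκ hlam hf ?_ fun n => ?_).trans
    (ENNReal.ofReal_le_ofReal (mul_le_mul_of_nonneg_left ?_ (by linarith)))
  · rintro (k | k) n
    · exact (hB₁ n).trans (le_max_left _ _)
    · exact (hB₂ n).trans (le_max_right _ _)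
  · simp only [Fintype.sum_sum_type, Sum.elim_inl, Sum.elim_inr, Finset.sum_const,
      Finset.card_univ, Fintype.card_fin, nsmul_eq_mul]
    by_cases hn : n ∈ G
    · have h1 : (w n : ℂ) ≠ 0 := by exact_mod_cast (hw n hn).ne'
      have h2 : (Z : ℂ) ≠ 0 := by exact_mod_cast (hZ n hn).ne'
      have h3 : (K₁ : ℂ) ≠ 0 := by exact_mod_cast hK₁.ne'
      rw [hr n hn]
      simp only [ha₁, ha₂, if_pos hn, mul_zero, add_zero]
      push_cast
      field_simp
    · have := toReal_mul_importance hp hK₂'.ne' n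
      simp only [ha₁, ha₂, if_neg hn, mul_zero, zero_add]
      exact_mod_cast this
  · simp only [Fintype.sum_sum_type, Sum.elim_inl, Sum.elim_inr, Finset.sum_const,
      Finset.card_univ, Fintype.card_fin, nsmul_eq_mul]
    refine add_le_add (le_of_eq ?_) ?_
    · rw [tsum_eq_sum (s := G) fun n hn => by simp [ha₁, hn], Finset.mul_sum, Finset.mul_sum]
      refine Finset.sum_congr rfl fun n hn => ?_
      have h1 := hw n hn
      have h2 := hZ n hn
      rw [hr n hn]
      simp only [ha₁, if_pos hn]
      rw [norm_mul, Complex.norm_real, Real.norm_of_nonneg (by positivity)]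
      exact weight_mul_sq hK₁'.ne' h1.ne' h2.ne' _
    · have hle : ∀ n, (p n).toReal * ‖a₂ n‖ ^ 2 ≤
          C'' / (K₂ : ℝ) ^ 2 * (if n ∈ G then 0 else ‖fourierCoefficient L f n‖) := fun n => by
        simp only [ha₂]
        split_ifs
        · simp
        · exact toReal_mul_norm_importance_sq_le hC hp hK₂' n
      have hs : Summable fun n => if n ∈ G then 0 else ‖fourierCoefficient L f n‖ :=
        Summable.of_nonneg_of_le (fun n => by split_ifs <;> simp)
          (fun n => by split_ifs <;> simp) hf.summable_norm
      have hs' := hs.mul_left (C'' / (K₂ : ℝ) ^ 2)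
      have := (Summable.of_nonneg_of_le (fun n => by positivity) hle hs').tsum_le_tsum hle hs'
      rw [tsum_mul_left] at this
      calc _ ≤ _ := mul_le_mul_of_nonneg_left this hK₂'.le
        _ = _ := by field_simp

/-- The combined amplitudes are the Fourier coefficients of the seed network. -/
theorem sum_combinedAmplitude_sub_sq_le (hρ : IsDataDensity L κ ρ) (hL : 0 < L) (hκ : 0 < κ)
    (hlam : 0 < lam) (hf : HasFourierSeries L f) (F : Finset (Fin d → ℤ)) :
    ∑ n ∈ F, ‖combinedAmplitude ν b n - fourierCoefficient L f n‖ ^ 2 ≤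
      loss L ρ lam f ν b / κ := by
  have h := sum_fourierCoefficient_sub_sq_le hρ hL hκ hf.continuous (continuous_network L ν b) F
  simp_rw [fourierCoefficient_network hL] at h
  rw [le_div_iff₀ hκ, mul_comm]
  refine h.trans ?_
  unfold loss
  have : 0 ≤ lam * ∑ k, ‖b k‖ ^ 2 := by positivity
  linarith

theorem loss_zero_le (hρ : IsDataDensity L κ ρ) (hL : 0 < L) (hκ : 0 < κ)
    (hf : HasFourierSeries L f) :
    loss L ρ lam f ν 0 ≤ (∑' n, ‖fourierCoefficient L f n‖) ^ 2 := by
  have hprob := hρ.isProbabilityMeasure hL hκ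
  unfold loss
  rw [genError_eq_integral hρ hL hκ]
  simp only [network, Pi.zero_apply, zero_mul, Finset.sum_const_zero, zero_sub, norm_neg, norm_zero,
    ne_eq, OfNat.ofNat_ne_zero, not_false_eq_true, zero_pow, mul_zero, add_zero]
  have hb : ∀ x, ‖f x‖ ^ 2 ≤ (∑' n, ‖fourierCoefficient L f n‖) ^ 2 := fun x =>
    pow_le_pow_left₀ (norm_nonneg _) (hf.norm_le x) 2
  have hint : Integrable (fun x => ‖f x‖ ^ 2) (dataMeasure L ρ) :=
    (memLp_of_measurable_of_norm_le _ 1 (hf.continuous.norm.pow 2).measurable fun x => by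
      rw [Pi.pow_apply, norm_pow, norm_norm]; exact hb x).integrable le_rfl
  exact (integral_mono hint (integrable_const _) hb).trans_eq (by simp)

/-- Comparison with zero amplitudes bounds `lam * ∑ |b|²` by the loss at zero; Cauchy–Schwarz over
the `K` amplitudes costs `√K`. -/
theorem sum_survivors_le (hρ : IsDataDensity L κ ρ) (hL : 0 < L) (hκ : 0 < κ)
    (hlam : 0 < lam) (hf : HasFourierSeries L f) (hb : IsSolution L ρ lam f ν b)
    (F : Finset (Fin d → ℤ)) :
    ∑ n ∈ F, ‖combinedAmplitude ν b n‖ ≤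
      √K * ((∑' n, ‖fourierCoefficient L f n‖) / √lam) := by
  refine (sum_norm_combinedAmplitude_le_sqrt F).trans
    (mul_le_mul_of_nonneg_left ?_ (Real.sqrt_nonneg _))
  have hS : 0 ≤ ∑' n, ‖fourierCoefficient L f n‖ := tsum_nonneg fun n => norm_nonneg _
  have h1 := (hb 0).trans (loss_zero_le hρ hL hκ hf)
  have h2 := genError_nonneg hρ hL hκ f (network L ν b)
  unfold loss at h1
  rw [Real.sqrt_le_iff, div_pow, Real.sq_sqrt hlam.le]
  refine ⟨by positivity, ?_⟩
  rw [le_div_iff₀ hlam]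
  linarith

/-- The variance of importance sampling with the perturbed weights `w` in place of `x`. -/
theorem sum_mul_sum_sq_div_le {ι : Type*} (G : Finset ι) (x w : ι → ℝ)
    (hε : 0 < ε) (hw : ∀ n ∈ G, ε ≤ w n) {D : ℝ} (hD : ∑ n ∈ G, (w n - x n) ^ 2 ≤ D) :
    (∑ n ∈ G, w n) * ∑ n ∈ G, x n ^ 2 / w n ≤
      (∑ n ∈ G, x n) ^ 2 + (∑ n ∈ G, w n) * (D / ε) := by
  have hw0 : 0 ≤ ∑ n ∈ G, w n := Finset.sum_nonneg fun n hn => hε.le.trans (hw n hn)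
  have hterm : ∀ n ∈ G, x n ^ 2 / w n ≤ 2 * x n - w n + (w n - x n) ^ 2 / ε := by
    intro n hn
    have h0 : 0 < w n := hε.trans_le (hw n hn)
    -- Exact expansion around `w = x`; only the quadratic remainder needs the cutoff `w ≥ ε`.
    have h1 : x n ^ 2 / w n = 2 * x n - w n + (w n - x n) ^ 2 / w n := by field_simp; ring
    rw [h1]
    exact add_le_add le_rfl (div_le_div_of_nonneg_left (sq_nonneg _) hε (hw n hn))
  have h1 : ∑ n ∈ G, x n ^ 2 / w n ≤ 2 * ∑ n ∈ G, x n - ∑ n ∈ G, w n + D / ε := by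
    refine (Finset.sum_le_sum hterm).trans ?_
    rw [Finset.sum_add_distrib, Finset.sum_sub_distrib, ← Finset.mul_sum, ← Finset.sum_div]
    exact add_le_add le_rfl (div_le_div_of_nonneg_right hD hε.le)
  have h2 := mul_le_mul_of_nonneg_left h1 hw0
  -- With `W = ∑ w` and `X = ∑ x`, the main part `2 W X - W²` is at most `X²`, however far the
  -- weights are from the optimum.
  nlinarith [sq_nonneg (∑ n ∈ G, x n - ∑ n ∈ G, w n)]

theorem sum_survivors_mul_sum_le (hρ : IsDataDensity L κ ρ) (hL : 0 < L) (hκ : 0 < κ)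
    (hlam : 0 < lam) (hf : HasFourierSeries L f) (hε : 0 < ε) (hb : IsSolution L ρ lam f ν b) :
    (∑ n ∈ survivors ε ν b, ‖combinedAmplitude ν b n‖) * (∑ n ∈ survivors ε ν b,
        ‖fourierCoefficient L f n‖ ^ 2 / ‖combinedAmplitude ν b n‖) ≤
      (∑' n, ‖fourierCoefficient L f n‖) ^ 2 +
        √K * ((∑' n, ‖fourierCoefficient L f n‖) / √lam) * (loss L ρ lam f ν b / κ / ε) := by
  have hD : ∑ n ∈ survivors ε ν b,
      (‖combinedAmplitude ν b n‖ - ‖fourierCoefficient L f n‖) ^ 2 ≤ loss L ρ lam f ν b / κ := by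
    refine (Finset.sum_le_sum fun n _ => ?_).trans
      (sum_combinedAmplitude_sub_sq_le hρ hL hκ hlam hf _)
    rw [← sq_abs]
    exact pow_le_pow_left₀ (abs_nonneg _) (abs_norm_sub_norm_le _ _) 2
  have hl := loss_nonneg (f := f) hρ hL hκ hlam ν b
  refine (sum_mul_sum_sq_div_le _ (fun n => ‖fourierCoefficient L f n‖)
    (fun n => ‖combinedAmplitude ν b n‖) hε
    (fun n hn => (mem_survivors hε).1 hn) hD).trans (add_le_add ?_ ?_)
  · exact pow_le_pow_left₀ (Finset.sum_nonneg fun _ _ => norm_nonneg _)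
      (hf.summable_norm.sum_le_tsum _ fun _ _ => norm_nonneg _) 2
  · exact mul_le_mul_of_nonneg_right (sum_survivors_le hρ hL hκ hlam hf hb _) (by positivity)

/-- A discarded mode with modulus `x ≥ 2ε` has deviation `y ≥ x / 2 ≥ ε`, so `x ≤ 2y ≤ 2y² / ε`. -/
theorem tsum_not_survivors_le (hρ : IsDataDensity L κ ρ) (hL : 0 < L) (hκ : 0 < κ)
    (hlam : 0 < lam) (hf : HasFourierSeries L f) (hε : 0 < ε) :
    ∑' n, (if n ∈ survivors ε ν b then 0 else ‖fourierCoefficient L f n‖) ≤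
      (∑' n, if ‖fourierCoefficient L f n‖ < 2 * ε then ‖fourierCoefficient L f n‖ else 0) +
        2 / ε * (loss L ρ lam f ν b / κ) := by
  have hnn : ∀ n : Fin d → ℤ, 0 ≤
      (if ‖fourierCoefficient L f n‖ < 2 * ε then ‖fourierCoefficient L f n‖ else 0) := fun n => by
    split_ifs <;> positivity
  have hs : Summable fun n : Fin d → ℤ =>
      (if ‖fourierCoefficient L f n‖ < 2 * ε then ‖fourierCoefficient L f n‖ else 0) :=
    Summable.of_nonneg_of_le hnn (fun n => by split_ifs <;> simp) hf.summable_norm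
  refine Real.tsum_le_of_sum_le (fun n => by split_ifs <;> simp) fun F => ?_
  have hterm : ∀ n ∈ F, (if n ∈ survivors ε ν b then 0 else ‖fourierCoefficient L f n‖) ≤
      (if ‖fourierCoefficient L f n‖ < 2 * ε then ‖fourierCoefficient L f n‖ else 0) +
        2 / ε * ‖combinedAmplitude ν b n - fourierCoefficient L f n‖ ^ 2 := by
    intro n _
    split_ifs with h1 h2 h2
    · positivity
    · positivity
    · exact le_add_of_nonneg_right (by positivity)
    · rw [mem_survivors hε, not_le] at h1
      rw [not_lt] at h2
      have h3 : ‖fourierCoefficient L f n‖ - ‖combinedAmplitude ν b n‖ ≤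
          ‖combinedAmplitude ν b n - fourierCoefficient L f n‖ := by
        rw [norm_sub_rev]; exact norm_sub_norm_le _ _
      set x := ‖fourierCoefficient L f n‖
      set y := ‖combinedAmplitude ν b n - fourierCoefficient L f n‖
      rw [zero_add, div_mul_eq_mul_div, le_div_iff₀ hε]
      have h4 : x ≤ 2 * y := by linarith
      have h5 : ε ≤ y := by linarith
      nlinarith
  refine (Finset.sum_le_sum hterm).trans ?_
  rw [Finset.sum_add_distrib, ← Finset.mul_sum]
  exact add_le_add (hs.sum_le_tsum _ fun n _ => hnn n) (mul_le_mul_of_nonneg_left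
    (sum_combinedAmplitude_sub_sq_le hρ hL hκ hlam hf F) (by positivity))

end Resampling

/-! ### Averaging over the seed and inserting the scaling. -/

/-- Expected minimal loss after resampling, before inserting the scaling of `ε` and `q`. -/
theorem lintegral_iInf_loss_resampleLaw_le {K : ℕ} {ε q L κ lam C'' : ℝ}
    {ρ : (Fin d → ℝ) → ℝ} {f : (Fin d → ℝ) → ℂ} {p r : PMF (Fin d → ℤ)}
    {β : (Fin K → Fin d → ℤ) → Fin K → ℂ} (hρ : IsDataDensity L κ ρ) (hL : 0 < L) (hκ : 0 < κ)
    (hlam : 0 < lam) (hf : HasFourierSeries L f) (hC : 0 ≤ C'')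
    (hp : ∀ n, ‖fourierCoefficient L f n‖ ≤ C'' * (p n).toReal) (hε : 0 < ε)
    (hK : 0 < K) (hK₁ : 0 < ⌊(K : ℝ) * (1 - q)⌋₊) (hK₂ : 0 < ⌈(K : ℝ) * q⌉₊)
    (hβ : ∀ ν, IsSolution L ρ lam f ν (β ν)) {S T : ℝ}
    (hS : S = ∑' n, ‖fourierCoefficient L f n‖)
    (hT : ∑' n, (if ‖fourierCoefficient L f n‖ < 2 * ε then ‖fourierCoefficient L f n‖ else 0) ≤
      T) :
    ∫⁻ s, ENNReal.ofReal (⨅ v, loss L ρ lam f s.2 v) ∂(resampleLaw p r ε q β) ≤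
      ENNReal.ofReal ((1 + lam) * (S ^ 2 / ⌊(K : ℝ) * (1 - q)⌋₊ + C'' / ⌈(K : ℝ) * q⌉₊ * T +
        (√K * (S / √lam) / ⌊(K : ℝ) * (1 - q)⌋₊ + 2 * C'' / ⌈(K : ℝ) * q⌉₊) / (κ * ε) *
          ((1 + lam) * (C'' / K * S)))) := by
  set K₁ := ⌊(K : ℝ) * (1 - q)⌋₊
  set K₂ := ⌈(K : ℝ) * q⌉₊
  have hK₁' : (0 : ℝ) < K₁ := by exact_mod_cast hK₁
  have hK₂' : (0 : ℝ) < K₂ := by exact_mod_cast hK₂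
  have hS0 : 0 ≤ S := hS ▸ tsum_nonneg fun n => norm_nonneg _
  have hT0 : 0 ≤ T := le_trans (tsum_nonneg fun n => by split_ifs <;> positivity) hT
  set A := (1 + lam) * (S ^ 2 / K₁ + C'' / K₂ * T) with hA
  set B := (1 + lam) * ((√K * (S / √lam) / K₁ + 2 * C'' / K₂) / (κ * ε)) with hB
  have hA0 : 0 ≤ A := by positivity
  have hB0 : 0 ≤ B := by positivity
  -- The conditional bound is affine in the seed loss, so only the mean of that loss is needed.
  have hcond : ∀ ν : Fin K → Fin d → ℤ,
      ∫⁻ ω, ENNReal.ofReal (⨅ v, loss L ρ lam f ω v) ∂(resampleKernel p r ε β K₁ K₂ ν) ≤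
        ENNReal.ofReal A + ENNReal.ofReal B * ENNReal.ofReal (⨅ v, loss L ρ lam f ν v) := by
    intro ν
    have hm : ⨅ v, loss L ρ lam f ν v = loss L ρ lam f ν (β ν) :=
      le_antisymm (iInf_loss_le hρ hL hκ hlam ν _) (le_ciInf (hβ ν))
    rw [hm, ← ENNReal.ofReal_mul hB0, ← ENNReal.ofReal_add hA0
      (mul_nonneg hB0 (loss_nonneg hρ hL hκ hlam ν _))]
    refine (lintegral_iInf_loss_resample_le hρ hL hκ hlam hf hC hp hε hK₁ hK₂ ν).trans
      (ENNReal.ofReal_le_ofReal ?_)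
    have h1 := sum_survivors_mul_sum_le hρ hL hκ hlam hf hε (hβ ν)
    have h2 := tsum_not_survivors_le (ν := ν) (b := β ν) hρ hL hκ hlam hf hε
    rw [← hS] at h1
    have h3 := div_le_div_of_nonneg_right h1 hK₁'.le
    have h4 := mul_le_mul_of_nonneg_left (h2.trans (add_le_add hT le_rfl))
      (show 0 ≤ C'' / K₂ by positivity)
    rw [hA, hB, mul_assoc, ← mul_add]
    refine mul_le_mul_of_nonneg_left ?_ (by linarith)
    rw [div_mul_eq_mul_div]
    refine (add_le_add h3 h4).trans_eq ?_
    field_simp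
    ring
  rw [resampleLaw, Measure.lintegral_compProd (measurable_of_countable _)]
  refine (lintegral_mono hcond).trans ?_
  rw [lintegral_add_left measurable_const, lintegral_const_mul _ (measurable_of_countable _),
    lintegral_const, measure_univ, mul_one]
  refine (add_le_add le_rfl (mul_le_mul_right
    (lintegral_iInf_loss_seed_le hρ hL hκ hlam hf hK hC hp) _)).trans ?_
  rw [← hS, ← ENNReal.ofReal_mul hB0, ← ENNReal.ofReal_add hA0 (by positivity)]
  refine ENNReal.ofReal_le_ofReal (le_of_eq ?_)
  rw [hA, hB]
  ring

/-- The error terms of the resampling bound are of relative order `q`. -/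
theorem resample_bound_le {K K₁ K₂ q ε S T κ lam C'' S₀ m₁ m₂ m₃ : ℝ} (hK : 0 < K) (hq : 0 < q)
    (hq4 : q ≤ 1 / 4) (hε : 0 < ε) (hκ : 0 < κ) (hlam : 0 < lam) (hS₀ : 0 < S₀) (hS : S₀ ≤ S)
    (hC : S ≤ C'') (hm₁ : 0 < m₁) (hm₂ : 0 < m₂) (hK₁ : K * (1 - 2 * q) ≤ K₁) (hK₂ : K * q ≤ K₂)
    (h₁ : m₁ ≤ q * ε * √K) (h₂ : m₂ * C'' ≤ q ^ 2 * ε * K) (hT : T ≤ m₃ * q ^ 2)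
    (hm₃ : 0 ≤ m₃) :
    (1 + lam) * (S ^ 2 / K₁ + C'' / K₂ * T +
        (√K * (S / √lam) / K₁ + 2 * C'' / K₂) / (κ * ε) * ((1 + lam) * (C'' / K * S))) ≤
      (1 + lam) / K * S ^ 2 * (1 + C'' * ((4 / S₀ + m₃ / S₀ ^ 2 + 2 * (1 + lam) / (κ * √lam * m₁) +
        2 * (1 + lam) / (κ * m₂ * S₀)) * √q)) := by
  have hS0 : 0 < S := hS₀.trans_le hS
  have hC0 : 0 < C'' := hS0.trans_le hC
  have hsK : 0 < √K := Real.sqrt_pos.2 hK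
  have hsl : 0 < √lam := Real.sqrt_pos.2 hlam
  have hq1 : q ≤ √q := Real.le_sqrt_of_sq_le (by nlinarith)
  have hK₁0 : 0 < K₁ := lt_of_lt_of_le (by nlinarith) hK₁
  have hK₂0 : 0 < K₂ := lt_of_lt_of_le (by positivity) hK₂
  have hr₁ : K / K₁ ≤ 1 + 4 * q := by
    rw [div_le_iff₀ hK₁0]
    nlinarith [mul_le_mul_of_nonneg_left hK₁ (show 0 ≤ 1 + 4 * q by positivity),
      mul_nonneg (mul_nonneg hK.le hq.le) (show 0 ≤ 1 / 4 - q by linarith)]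
  have hr₁' : K / K₁ ≤ 2 := by linarith
  have hr₂ : K / K₂ ≤ 1 / q := by
    rw [div_le_div_iff₀ hK₂0 hq]; linarith
  have t₁ : K / K₁ * S ^ 2 ≤ S ^ 2 + S ^ 2 * C'' * (4 / S₀) * q := by
    -- The rounding error carries no `C''` of its own; `S₀ ≤ S ≤ C''` supplies the factor.
    have : 1 ≤ C'' / S₀ := by rw [one_le_div hS₀]; linarith
    calc _ ≤ (1 + 4 * q) * S ^ 2 := mul_le_mul_of_nonneg_right hr₁ (sq_nonneg _)
      _ ≤ S ^ 2 + (4 * q * S ^ 2) * (C'' / S₀) := by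
        have := le_mul_of_one_le_right (show 0 ≤ 4 * q * S ^ 2 by positivity) this
        linarith
      _ = _ := by ring
  have t₂ : K / K₂ * C'' * T ≤ S ^ 2 * C'' * (m₃ / S₀ ^ 2) * q := by
    have h : 1 ≤ S ^ 2 / S₀ ^ 2 := by
      rw [one_le_div (by positivity)]; exact pow_le_pow_left₀ hS₀.le hS 2
    calc _ ≤ K / K₂ * C'' * (m₃ * q ^ 2) := mul_le_mul_of_nonneg_left hT (by positivity)
      _ ≤ 1 / q * C'' * (m₃ * q ^ 2) := by gcongr
      _ = C'' * m₃ * q := by field_simp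
      _ ≤ (C'' * m₃ * q) * (S ^ 2 / S₀ ^ 2) := le_mul_of_one_le_right (by positivity) h
      _ = _ := by ring
  have t₃ : K / K₁ * (√K * (S / √lam)) / (κ * ε) * ((1 + lam) * (C'' / K * S)) ≤
      S ^ 2 * C'' * (2 * (1 + lam) / (κ * √lam * m₁)) * q := by
    have h : 1 / (ε * √K) ≤ q / m₁ := by
      rw [div_le_div_iff₀ (by positivity) hm₁]; linarith
    have hsq : √K * √K = K := Real.mul_self_sqrt hK.le
    calc _ ≤ 2 * (√K * (S / √lam)) / (κ * ε) * ((1 + lam) * (C'' / K * S)) := by gcongr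
      _ = S ^ 2 * C'' * (2 * (1 + lam) / (κ * √lam)) * (1 / (ε * √K)) := by
        nth_rewrite 2 [← hsq]
        field_simp
      _ ≤ S ^ 2 * C'' * (2 * (1 + lam) / (κ * √lam)) * (q / m₁) := by gcongr
      _ = _ := by field_simp
  have t₄ : K / K₂ * (2 * C'') / (κ * ε) * ((1 + lam) * (C'' / K * S)) ≤
      S ^ 2 * C'' * (2 * (1 + lam) / (κ * m₂ * S₀)) * q := by
    -- This term is quadratic in `C''`; the second factor is absorbed by `h₂`, which holds once `K`
    -- is large depending on `C''`.
    have h : C'' / (q * ε * K) ≤ q / m₂ := by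
      rw [div_le_div_iff₀ (by positivity) hm₂]; nlinarith
    have h' : 1 ≤ S / S₀ := by rwa [one_le_div hS₀]
    calc _ ≤ 1 / q * (2 * C'') / (κ * ε) * ((1 + lam) * (C'' / K * S)) := by gcongr
      _ = S * C'' * (2 * (1 + lam) / κ) * (C'' / (q * ε * K)) := by field_simp
      _ ≤ S * C'' * (2 * (1 + lam) / κ) * (q / m₂) := by gcongr
      _ ≤ S * C'' * (2 * (1 + lam) / κ) * (q / m₂) * (S / S₀) :=
        le_mul_of_one_le_right (by positivity) h'
      _ = _ := by field_simp
  set M := 4 / S₀ + m₃ / S₀ ^ 2 + 2 * (1 + lam) / (κ * √lam * m₁) +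
    2 * (1 + lam) / (κ * m₂ * S₀) with hM
  have hM0 : 0 ≤ M := by positivity
  calc _ = (1 + lam) / K * (K / K₁ * S ^ 2 + K / K₂ * C'' * T +
        K / K₁ * (√K * (S / √lam)) / (κ * ε) * ((1 + lam) * (C'' / K * S)) +
        K / K₂ * (2 * C'') / (κ * ε) * ((1 + lam) * (C'' / K * S))) := by field_simp; ring
    _ ≤ (1 + lam) / K * (S ^ 2 + S ^ 2 * C'' * M * q) := by
        refine mul_le_mul_of_nonneg_left ?_ (by positivity)
        have : S ^ 2 * C'' * M * q = S ^ 2 * C'' * (4 / S₀) * q +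
            S ^ 2 * C'' * (m₃ / S₀ ^ 2) * q +
            S ^ 2 * C'' * (2 * (1 + lam) / (κ * √lam * m₁)) * q +
            S ^ 2 * C'' * (2 * (1 + lam) / (κ * m₂ * S₀)) * q := by rw [hM]; ring
        linarith
    _ ≤ (1 + lam) / K * (S ^ 2 + S ^ 2 * C'' * M * √q) := by gcongr
    _ = _ := by ring

/-- Consequences of the scaling `ε ∼ X⁻¹`, `q ∼ X^{-(1-s)/2}`, `K = X^{3-s}`. -/
theorem scaling_bounds {s X K ε q c₁ C₁ c₂ : ℝ} (hs1 : s < 1) (hX : 0 < X)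
    (hK : K = X ^ (3 - s)) (hc₁ : 0 < c₁) (hc₂ : 0 < c₂)
    (h₁ : c₁ ≤ ε * X) (h₂ : ε * X ≤ C₁) (h₃ : c₂ ≤ q * X ^ ((1 - s) / 2)) :
    c₁ * c₂ ≤ q * ε * √K ∧ c₁ * c₂ ^ 2 * X ≤ q ^ 2 * ε * K ∧
      (2 * ε) ^ (1 - s) ≤ (2 * C₁) ^ (1 - s) / c₂ ^ 2 * q ^ 2 := by
  set Y := X ^ ((1 - s) / 2) with hY
  have hY0 : 0 < Y := by positivity
  have hY2 : Y ^ 2 = X ^ (1 - s) := by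
    rw [hY, ← Real.rpow_natCast, ← Real.rpow_mul hX.le]; congr 1; push_cast; ring
  -- Thus `√K = X Y` with `ε ∼ X⁻¹` and `q ∼ Y⁻¹`, which reduces the first two bounds to products of
  -- the hypotheses.
  have hKY : K = (X * Y) ^ 2 := by
    rw [hK, mul_pow, hY2, ← Real.rpow_natCast X 2, ← Real.rpow_add hX]; congr 1; push_cast; ring
  have hε : 0 < ε := pos_of_mul_pos_left (hc₁.trans_le h₁) hX.le
  have hq : 0 < q := pos_of_mul_pos_left (hc₂.trans_le h₃) hY0.le
  have h₃' : c₂ ^ 2 ≤ q ^ 2 * X ^ (1 - s) := by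
    rw [← hY2, ← mul_pow]; exact pow_le_pow_left₀ hc₂.le h₃ 2
  refine ⟨?_, ?_, ?_⟩
  · rw [hKY, Real.sqrt_sq (by positivity)]
    calc _ ≤ (ε * X) * (q * Y) := mul_le_mul h₁ h₃ hc₂.le (by positivity)
      _ = _ := by ring
  · rw [hKY, mul_pow, hY2]
    calc _ ≤ (ε * X) * (q ^ 2 * X ^ (1 - s)) * X := by gcongr
      _ = _ := by ring
  · have hC₁ : 0 < C₁ := (hc₁.trans_le h₁).trans_le h₂
    rw [div_mul_eq_mul_div, le_div_iff₀ (by positivity)]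
    calc _ ≤ (2 * ε) ^ (1 - s) * (q ^ 2 * X ^ (1 - s)) := by gcongr
      _ = (2 * (ε * X)) ^ (1 - s) * q ^ 2 := by
        rw [← mul_assoc 2, Real.mul_rpow (by positivity) hX.le]; ring
      _ ≤ _ := by
        have : (2 * (ε * X)) ^ (1 - s) ≤ (2 * C₁) ^ (1 - s) :=
          Real.rpow_le_rpow (by positivity) (by linarith) (by linarith)
        gcongr

/-- Since `b < 1`, both `q → 0` and `K q → ∞`. `D` will be `C''`: this is the only way in which `K₀`
depends on it. -/
theorem exists_sample_size {a b c₂ C₂ D : ℝ} (ha : 0 < a) (hb : 0 < b) (hb1 : b < 1)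
    (hc₂ : 0 < c₂) :
    ∃ K₀ : ℕ, ∀ K : ℕ, K₀ ≤ K → 1 ≤ K ∧ D ≤ (K : ℝ) ^ a ∧ 1 ≤ (K : ℝ) ^ a ∧
      ∀ q : ℝ, c₂ ≤ q * (K : ℝ) ^ b → q * (K : ℝ) ^ b ≤ C₂ → q ≤ 1 / 4 ∧ 1 ≤ K * q := by
  have T : ∀ e : ℝ, 0 < e → Filter.Tendsto (fun K : ℕ => (K : ℝ) ^ e) Filter.atTop Filter.atTop :=
    fun e he => (tendsto_rpow_atTop he).comp tendsto_natCast_atTop_atTop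
  obtain ⟨K₀, h⟩ := Filter.eventually_atTop.1 ((Filter.eventually_ge_atTop 1).and
    (((T a ha).eventually_ge_atTop D).and (((T a ha).eventually_ge_atTop 1).and
    (((T b hb).eventually_ge_atTop (4 * C₂)).and
      ((T (1 - b) (by linarith)).eventually_ge_atTop (1 / c₂))))))
  refine ⟨K₀, fun K hK => ?_⟩
  obtain ⟨h1, h2, h3, h4, h5⟩ := h K hK
  refine ⟨h1, h2, h3, fun q hq₁ hq₂ => ?_⟩
  have hK0 : (0 : ℝ) < K := by exact_mod_cast h1
  have hb0 : 0 < (K : ℝ) ^ b := by positivity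
  refine ⟨?_, ?_⟩
  · by_contra hq
    nlinarith
  · have hsplit : (K : ℝ) = (K : ℝ) ^ (1 - b) * (K : ℝ) ^ b := by
      rw [← Real.rpow_add hK0, sub_add_cancel, Real.rpow_one]
    calc (1 : ℝ) = 1 / c₂ * c₂ := by field_simp
      _ ≤ (K : ℝ) ^ (1 - b) * (q * (K : ℝ) ^ b) := mul_le_mul h5 hq₁ hc₂.le (by positivity)
      _ = ((K : ℝ) ^ (1 - b) * (K : ℝ) ^ b) * q := by ring
      _ = _ := by rw [← hsplit]

end RandomFeatures

/-! ### The main theorem. -/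

theorem theorem1 (d : ℕ) (hd : 1 ≤ d) (ℓ c C lam κ c₁ C₁ c₂ C₂ : ℝ) (hℓ : (d : ℝ) < ℓ)
    (hc : 0 < c) (hC : 0 < C) (hlam : 0 < lam) (hκ : 0 < κ)
    (hc₁ : 0 < c₁) (hC₁ : 0 < C₁) (hc₂ : 0 < c₂) (hC₂ : 0 < C₂) :
    ∃ M : ℝ, 0 < M ∧ ∀ C'' : ℝ, ∃ K₀ : ℕ, ∀ K : ℕ, K₀ ≤ K → ∀ ε q : ℝ,
      c₁ ≤ ε * (K : ℝ) ^ (1 / (3 - d / ℓ)) → ε * (K : ℝ) ^ (1 / (3 - d / ℓ)) ≤ C₁ →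
      c₂ ≤ q * (K : ℝ) ^ ((1 - d / ℓ) / (6 - 2 * d / ℓ)) →
      q * (K : ℝ) ^ ((1 - d / ℓ) / (6 - 2 * d / ℓ)) ≤ C₂ → q ≤ 1 →
      ∀ (L : ℝ) (f : (Fin d → ℝ) → ℂ) (ρ : (Fin d → ℝ) → ℝ) (p r : PMF (Fin d → ℤ))
        (β : (Fin K → Fin d → ℤ) → Fin K → ℂ)
        (α : (Fin ⌊(K : ℝ) * (1 - q)⌋₊ ⊕ Fin ⌈(K : ℝ) * q⌉₊ → Fin d → ℤ) →
          Fin ⌊(K : ℝ) * (1 - q)⌋₊ ⊕ Fin ⌈(K : ℝ) * q⌉₊ → ℂ),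
        0 < L →
        RandomFeatures.HasFourierSeries L f →
        RandomFeatures.HasDecay L c C ℓ f →
        RandomFeatures.IsDataDensity L κ ρ →
        (⨆ n, ‖RandomFeatures.fourierCoefficient L f n‖ₑ / p n) ≤ ENNReal.ofReal C'' →
        (∀ ν, RandomFeatures.IsSolution L ρ lam f ν (β ν)) →
        (∀ ω, RandomFeatures.IsSolution L ρ lam f ω (α ω)) →
        (∫⁻ s, ENNReal.ofReal
              (RandomFeatures.genError L ρ f (RandomFeatures.network L s.2 (α s.2)))
            ∂(RandomFeatures.resampleLaw p r ε q β)
          ≤ ∫⁻ s, ENNReal.ofReal (⨅ v, RandomFeatures.loss L ρ lam f s.2 v)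
              ∂(RandomFeatures.resampleLaw p r ε q β)) ∧
        (∫⁻ s, ENNReal.ofReal (⨅ v, RandomFeatures.loss L ρ lam f s.2 v)
            ∂(RandomFeatures.resampleLaw p r ε q β)
          ≤ ENNReal.ofReal ((1 + lam) / K * (∑' n, ‖RandomFeatures.fourierCoefficient L f n‖) ^ 2
              * (1 + C'' * (M * √q)))) ∧
        IsLeast (Set.range (RandomFeatures.rateConstant L f))
          (ENNReal.ofReal ((∑' n, ‖RandomFeatures.fourierCoefficient L f n‖) ^ 2)) := by
 
  have hd' : (0 : ℝ) < d := by exact_mod_cast hd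
  have hℓ0 : 0 < ℓ := hd'.trans hℓ
  set s : ℝ := d / ℓ with hs
  have hs0 : 0 < s := div_pos hd' hℓ0
  have hs1 : s < 1 := (div_lt_one hℓ0).2 hℓ
  have hexp : (1 - s) / (6 - 2 * d / ℓ) = 1 / (3 - s) * ((1 - s) / 2) := by
    have h3 : 3 - s ≠ 0 := by linarith
    rw [show 6 - 2 * d / ℓ = 2 * (3 - s) by rw [hs]; ring]
    field_simp
  rw [hexp]
  set a : ℝ := 1 / (3 - s) with ha
  have ha0 : 0 < a := one_div_pos.2 (by linarith)
  have ha1 : a < 1 := by rw [ha, div_lt_one (by linarith)]; linarith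
  have hb0 : 0 < a * ((1 - s) / 2) := mul_pos ha0 (by linarith)
  have hb1 : a * ((1 - s) / 2) < 1 := by nlinarith
  set S₀ : ℝ := c ^ ℓ with hS₀
  have hS₀0 : 0 < S₀ := by positivity
  -- Collects the tail bound at `t = 2ε`: the linear term is turned into `(2ε) ^ (1 - s)` at the
  -- cost of `(2C₁) ^ s`, and that power is `O(q²)`.
  set m₃ : ℝ := ((2 * C₁) ^ s + (3 * C) ^ d / (1 - s)) * ((2 * C₁) ^ (1 - s) / c₂ ^ 2) with hm₃
  have hs1' : 0 < 1 - s := by linarith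
  have hm₃0 : 0 ≤ m₃ := by positivity
  refine ⟨4 / S₀ + m₃ / S₀ ^ 2 + 2 * (1 + lam) / (κ * √lam * (c₁ * c₂)) +
    2 * (1 + lam) / (κ * (c₁ * c₂ ^ 2) * S₀), by positivity, fun C'' => ?_⟩
  obtain ⟨K₀, hK₀⟩ := RandomFeatures.exists_sample_size (C₂ := C₂) (D := C'') ha0 hb0 hb1 hc₂
  refine ⟨K₀, fun K hK ε q hε₁ hε₂ hq₁ hq₂ _ L f ρ p r β α hL hf hdec hρ hp hβ hα => ?_⟩
  obtain ⟨hK1, hXC, hX1, hqK⟩ := hK₀ K hK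
  obtain ⟨hq4, hKq⟩ := hqK q hq₁ hq₂
  have hK0 : (0 : ℝ) < K := by exact_mod_cast hK1
  rw [Real.rpow_mul hK0.le] at hq₁
  set X : ℝ := (K : ℝ) ^ a with hX
  have hX0 : 0 < X := by linarith
  have hKX : (K : ℝ) = X ^ (3 - s) := by
    rw [hX, ← Real.rpow_mul hK0.le, ha, one_div_mul_cancel (by linarith), Real.rpow_one]
  have hε : 0 < ε := pos_of_mul_pos_left (hc₁.trans_le hε₁) hX0.le
  have hq : 0 < q := pos_of_mul_pos_right (one_pos.trans_le hKq) hK0.le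
  have hS : S₀ ≤ _ := hdec.rpow_le_tsum_norm hf hd
  have hp' := RandomFeatures.norm_fourierCoefficient_le_mul hp
  have hSC := RandomFeatures.tsum_norm_fourierCoefficient_le hf hp'
  have hC''0 : 0 < C'' := by
    by_contra h
    rw [max_eq_right (not_lt.1 h)] at hSC
    linarith
  rw [max_eq_left hC''0.le] at hSC hp'
  obtain ⟨h₁, h₂, h₃⟩ := RandomFeatures.scaling_bounds hs1 hX0 hKX hc₁ hc₂ hε₁ hε₂ hq₁
  have hT : 2 * ε + (3 * C) ^ d * ((2 * ε) ^ (1 - s) / (1 - s)) ≤ m₃ * q ^ 2 := by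
    have hεC : ε ≤ C₁ := by nlinarith
    have h2ε : 2 * ε ≤ (2 * C₁) ^ s * (2 * ε) ^ (1 - s) := by
      calc 2 * ε = (2 * ε) ^ s * (2 * ε) ^ (1 - s) := by
            rw [← Real.rpow_add (by positivity), add_sub_cancel, Real.rpow_one]
        _ ≤ _ := by gcongr
    calc _ ≤ ((2 * C₁) ^ s + (3 * C) ^ d / (1 - s)) * (2 * ε) ^ (1 - s) := by
          rw [add_mul]
          refine add_le_add h2ε (le_of_eq ?_)
          ring
      _ ≤ ((2 * C₁) ^ s + (3 * C) ^ d / (1 - s)) * ((2 * C₁) ^ (1 - s) / c₂ ^ 2 * q ^ 2) := by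
          gcongr
      _ = _ := by rw [hm₃]; ring
  have hT' := (hdec.tsum_small_le hf hC hd hℓ (t := 2 * ε) (by positivity)).trans hT
  -- The floor loses less than one, which is at most `K q`.
  have hK₁ : (K : ℝ) * (1 - 2 * q) ≤ ⌊(K : ℝ) * (1 - q)⌋₊ := by
    have := Nat.lt_floor_add_one ((K : ℝ) * (1 - q))
    linarith
  have hK₂ : (K : ℝ) * q ≤ ⌈(K : ℝ) * q⌉₊ := Nat.le_ceil _
  refine ⟨lintegral_mono fun ω => ENNReal.ofReal_le_ofReal ?_, ?_,
    RandomFeatures.isLeast_rateConstant hf (hS₀0.trans_le hS)⟩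
  · refine le_trans ?_ (le_ciInf (hα ω.2))
    unfold RandomFeatures.loss
    have : 0 ≤ lam * ∑ k, ‖α ω.2 k‖ ^ 2 := by positivity
    linarith
  · clear_value m₃ S₀ X a s
    have hK₁0 : (0 : ℝ) < ⌊(K : ℝ) * (1 - q)⌋₊ := lt_of_lt_of_le (mul_pos hK0 (by linarith)) hK₁
    have hK₂0 : (0 : ℝ) < ⌈(K : ℝ) * q⌉₊ := lt_of_lt_of_le (mul_pos hK0 hq) hK₂
    refine (RandomFeatures.lintegral_iInf_loss_resampleLaw_le hρ hL hκ hlam hf hC''0.le hp' hε hK1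
      ?_ ?_ hβ rfl hT').trans
      (ENNReal.ofReal_le_ofReal ?_)
    · exact_mod_cast hK₁0
    · exact_mod_cast hK₂0
    · exact RandomFeatures.resample_bound_le hK0 hq hq4 hε hκ hlam hS₀0 hS hSC (by positivity)
        (by positivity) hK₁ hK₂ h₁ (le_trans (by gcongr) h₂) le_rfl hm₃0
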